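/- Let $p$ be a prime number and let $X$ be a scheme in characteristic $p$ (that is, $p=0$ in $\mathcal O_X$) which is locally of finite type over a field or over a Dedekind domain. Let $F\colon X\to X$ be the absolute $p$-th power Frobenius, and let $D\subset X$ be an effective Cartier divisor. Assume that 1. $X$ is Frobenius split, i.e. the map $\mathcal O_X\to F_*\mathcal O_X$ splits as a map of $\mathcal O_X$-modules; 2. $X$ splits relative to $D$, i.e. the composition $\mathcal O_X\to F_*\mathcal O_X\hookrightarrow F_*\mathcal O_X(D)$ splits as a map of $\mathcal O_X$-modules; 3. the open subscheme $X\setminus D$ is Cohen–Macaulay. Then $X$ is Cohen–Macaulay. -/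

import Mathlib

open CategoryTheory AlgebraicGeometry TopologicalSpace Opposite

universe u

noncomputable section

/-! ## Cohen–Macaulay schemes -/

/-- The depth of a local ring: the supremum of the lengths of the regular sequences
contained in the maximal ideal. -/
def localRingDepth (R : Type u) [CommRing R] [IsLocalRing R] : ℕ∞ :=
  ⨆ rs : {rs : List R // (∀ r ∈ rs, r ∈ IsLocalRing.maximalIdeal R) ∧
    RingTheory.Sequence.IsRegular R rs}, (rs.1.length : ℕ∞)

/-- A local ring is Cohen–Macaulay if it is Noetherian and its depth equals its Krull dimension. -/
structure IsCohenMacaulayLocalRing (R : Type u) [CommRing R] [IsLocalRing R] : Prop where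
  isNoetherianRing : IsNoetherianRing R
  depth_eq : (localRingDepth R : WithBot ℕ∞) = ringKrullDim R

/-- A scheme is Cohen–Macaulay if it is locally Noetherian and all its local rings are
Cohen–Macaulay. -/
structure IsCohenMacaulayScheme (X : Scheme.{u}) : Prop where
  isLocallyNoetherian : IsLocallyNoetherian X
  stalk : ∀ x : X, IsCohenMacaulayLocalRing (X.presheaf.stalk x)

/-! ## The absolute Frobenius -/

/-- `X` is a scheme in characteristic `p`, i.e. `p = 0` in `𝒪_X`. -/
class IsSchemeInChar (X : Scheme.{u}) (p : ℕ) : Prop where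
  natCast_eq_zero : (p : Γ(X, ⊤)) = 0

lemma IsSchemeInChar.natCast_section (X : Scheme.{u}) (p : ℕ) [h : IsSchemeInChar X p]
    (U : X.Opens) : (p : Γ(X, U)) = 0 := by
  have := congrArg (X.presheaf.map (homOfLE (le_top : U ≤ ⊤)).op).hom h.natCast_eq_zero
  simpa using this

/-- The `p`-th power ring endomorphism `a ↦ a ^ p` of a commutative ring in which the prime
number `p` is zero (the zero ring is allowed). -/
def powRingHom (R : Type u) [CommRing R] (p : ℕ) [hp : Fact p.Prime] (h : (p : R) = 0) :
    R →+* R where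
  toFun a := a ^ p
  map_one' := one_pow p
  map_mul' a b := mul_pow a b p
  map_zero' := zero_pow hp.out.ne_zero
  map_add' a b := by
    obtain ⟨r, hr⟩ := exists_add_pow_prime_eq hp.out a b
    rw [hr, h]; simp

/-- The absolute Frobenius as a map of sheaves of rings: `a ↦ a ^ p` on all sections. -/
def frobeniusSheafHom (X : Scheme.{u}) (p : ℕ) [Fact p.Prime] [IsSchemeInChar X p] :
    X.presheaf ⟶ (TopCat.Presheaf.pushforward CommRingCat (𝟙 X.toTopCat)).obj X.presheaf where
  app U := CommRingCat.ofHom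
    (powRingHom (X.presheaf.obj U) p (IsSchemeInChar.natCast_section X p U.unop))
  naturality U V i := by
    ext a
    exact ((X.presheaf.map i).hom.map_pow a p).symm

/-- The absolute Frobenius `F : X ⟶ X` of a scheme in characteristic `p`: the identity on the
underlying space and `a ↦ a ^ p` on sections. -/
def absoluteFrobenius (X : Scheme.{u}) (p : ℕ) [Fact p.Prime] [IsSchemeInChar X p] : X ⟶ X :=
  ⟨⟨⟨𝟙 X.toTopCat, frobeniusSheafHom X p⟩, by
    intro x
    constructor
    intro a ha
    obtain ⟨U, hxU, s, rfl⟩ := X.presheaf.exists_germ_eq a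
    have key : (PresheafedSpace.Hom.stalkMap (X := X.toPresheafedSpace) (Y := X.toPresheafedSpace)
        ⟨𝟙 X.toTopCat, frobeniusSheafHom X p⟩ x).hom (X.presheaf.germ U x hxU s) =
        (X.presheaf.germ U x hxU s) ^ p := by
      refine (PresheafedSpace.stalkMap_germ_apply (X := X.toPresheafedSpace)
        (Y := X.toPresheafedSpace) ⟨𝟙 X.toTopCat, frobeniusSheafHom X p⟩ U x hxU s).trans ?_
      exact (X.presheaf.germ U x hxU).hom.map_pow s p
    exact (isUnit_pow_iff (Fact.out : p.Prime).ne_zero).mp (key ▸ ha)⟩⟩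

/-! ## Effective Cartier divisors and the invertible sheaf of a divisor -/

/-- The structure sheaf as a module over itself. -/
abbrev structureModule (X : Scheme.{u}) : X.Modules := SheafOfModules.unit.{u} X.ringCatSheaf

/-- For a morphism `f : X ⟶ Y`, the canonical map `𝒪_Y ⟶ f_* 𝒪_X` of `𝒪_Y`-modules. -/
def toPushforwardStructureModule {X Y : Scheme.{u}} (f : X ⟶ Y) :
    structureModule Y ⟶ (Scheme.Modules.pushforward f).obj (structureModule X) :=
  SheafOfModules.unitToPushforwardObjUnit f.toRingCatSheafHom

/-- An effective Cartier divisor: a closed subscheme, given by its (quasi-coherent) ideal sheaf,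
which is locally cut out by one non-zero-divisor. -/
structure EffectiveCartierDivisor (X : Scheme.{u}) where
  /-- the ideal sheaf `𝒪_X(-D)` of the divisor -/
  idealSheaf : X.IdealSheafData
  locally_principal : ∀ x : X, ∃ U : X.affineOpens, x ∈ U.1 ∧
    ∃ f ∈ nonZeroDivisors Γ(X, U), idealSheaf.ideal U = Ideal.span {f}

namespace EffectiveCartierDivisor

variable {X : Scheme.{u}} (D : EffectiveCartierDivisor X)

/-- The open subscheme `X \ D`. -/
def compl : X.Opens := D.idealSheaf.support.compl

/-- The `𝒪_X`-module `j_* 𝒪_{X \ D}`, where `j : X \ D ⟶ X` is the inclusion. -/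
def meromorphic : X.Modules :=
  (Scheme.Modules.pushforward D.compl.ι).obj (structureModule D.compl.toScheme)

/-- A section `s` of `j_* 𝒪_{X \ D}` over `V` is a section of `𝒪_X(D)` if
`𝒪_X(-D) · s ⊆ 𝒪_X`: for every local equation `f ∈ 𝒪_X(-D)` the function `f s` extends, locally,
from the complement of `D` to a regular function. -/
def IsSectionOfSheaf (V : X.Opens) (s : Γ(D.compl, D.compl.ι ⁻¹ᵁ V)) : Prop :=
  ∀ (W : X.affineOpens) (hWV : W.1 ≤ V), ∀ f ∈ D.idealSheaf.ideal W, ∀ x ∈ W.1,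
    ∃ (W' : X.Opens) (hW' : W' ≤ W.1) (_ : x ∈ W') (g : Γ(X, W')),
      D.compl.ι.app W' g =
        D.compl.ι.app W' (X.presheaf.map (homOfLE hW').op f) *
          D.compl.toScheme.presheaf.map
            ((Opens.map D.compl.ι.base).map (homOfLE (hW'.trans hWV))).op s

lemma ι_app_map {V V' : X.Opens} (h : V' ≤ V) (a : Γ(X, V)) :
    D.compl.ι.app V' (X.presheaf.map (homOfLE h).op a) =
      D.compl.toScheme.presheaf.map ((Opens.map D.compl.ι.base).map (homOfLE h)).op
        (D.compl.ι.app V a) :=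
  congr($(D.compl.ι.naturality (homOfLE h).op) a)

variable {D} in
lemma IsSectionOfSheaf.add {V : X.Opens} {s t : Γ(D.compl, D.compl.ι ⁻¹ᵁ V)}
    (hs : D.IsSectionOfSheaf V s) (ht : D.IsSectionOfSheaf V t) :
    D.IsSectionOfSheaf V (s + t) := by
  intro W hWV f hf x hx
  obtain ⟨W₁, h₁, hx₁, g₁, e₁⟩ := hs W hWV f hf x hx
  obtain ⟨W₂, h₂, hx₂, g₂, e₂⟩ := ht W hWV f hf x hx
  refine ⟨W₁ ⊓ W₂, inf_le_left.trans h₁, ⟨hx₁, hx₂⟩,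
    X.presheaf.map (homOfLE (inf_le_left : W₁ ⊓ W₂ ≤ W₁)).op g₁ +
      X.presheaf.map (homOfLE (inf_le_right : W₁ ⊓ W₂ ≤ W₂)).op g₂, ?_⟩
  rw [map_add, ι_app_map, ι_app_map, e₁, e₂, map_mul, map_mul, ← ι_app_map, ← ι_app_map, map_add,
    mul_add]
  simp only [← ConcreteCategory.comp_apply, ← Functor.map_comp]
  rfl

variable {D} in
lemma IsSectionOfSheaf.smul {V : X.Opens} {s : Γ(D.compl, D.compl.ι ⁻¹ᵁ V)}
    (hs : D.IsSectionOfSheaf V s) (a : Γ(X, V)) :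
    D.IsSectionOfSheaf V (D.compl.ι.app V a * s) := by
  intro W hWV f hf x hx
  obtain ⟨W₁, h₁, hx₁, g₁, e₁⟩ := hs W hWV f hf x hx
  refine ⟨W₁, h₁, hx₁, X.presheaf.map (homOfLE (h₁.trans hWV)).op a * g₁, ?_⟩
  rw [map_mul, map_mul, e₁, ι_app_map _ (h₁.trans hWV), mul_left_comm]

lemma isSectionOfSheaf_zero (V : X.Opens) : D.IsSectionOfSheaf V 0 := by
  intro W hWV f hf x hx
  exact ⟨W.1, le_rfl, hx, 0, by simp⟩

/-- Regular functions are sections of `𝒪_X(D)`. -/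
lemma isSectionOfSheaf_app (V : X.Opens) (a : Γ(X, V)) :
    D.IsSectionOfSheaf V (D.compl.ι.app V a) := by
  intro W hWV f hf x hx
  refine ⟨W.1, le_rfl, hx, f * X.presheaf.map (homOfLE hWV).op a, ?_⟩
  rw [map_mul, ι_app_map _ hWV]
  congr 1
  rw [ι_app_map]
  exact congr($(D.compl.toScheme.presheaf.map_id _) _).symm

variable {D} in
lemma IsSectionOfSheaf.map {V V' : X.Opens} (h : V' ≤ V) {s : Γ(D.compl, D.compl.ι ⁻¹ᵁ V)}
    (hs : D.IsSectionOfSheaf V s) :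
    D.IsSectionOfSheaf V' (D.compl.toScheme.presheaf.map
      ((Opens.map D.compl.ι.base).map (homOfLE h)).op s) := by
  intro W hWV f hf x hx
  obtain ⟨W₁, h₁, hx₁, g₁, e₁⟩ := hs W (hWV.trans h) f hf x hx
  refine ⟨W₁, h₁, hx₁, g₁, e₁.trans ?_⟩
  congr 1
  rw [← ConcreteCategory.comp_apply, ← Functor.map_comp]
  rfl

/-- The condition defining `𝒪_X(D)` is local. -/
lemma isSectionOfSheaf_of_locally (V : X.Opens) (s : Γ(D.compl, D.compl.ι ⁻¹ᵁ V))
    (hs : ∀ x ∈ V, ∃ (V' : X.Opens) (h : V' ≤ V) (_ : x ∈ V'),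
      D.IsSectionOfSheaf V' (D.compl.toScheme.presheaf.map
        ((Opens.map D.compl.ι.base).map (homOfLE h)).op s)) :
    D.IsSectionOfSheaf V s := by
  intro W hWV f hf x hx
  obtain ⟨V', h, hxV', hV'⟩ := hs x (hWV hx)
  obtain ⟨U, hU, hxU, hUle⟩ := X.isBasis_affineOpens.exists_subset_of_mem_open
    (show x ∈ ((W.1 ⊓ V' : X.Opens) : Set X) from ⟨hx, hxV'⟩) (W.1 ⊓ V').2
  obtain ⟨U, hU, rfl⟩ := hU
  have hUW : U ≤ W.1 := fun y hy => (hUle hy).1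
  have hUV : U ≤ V' := fun y hy => (hUle hy).2
  obtain ⟨W₁, h₁, hx₁, g₁, e₁⟩ := hV' ⟨U, hU⟩ hUV
    (X.presheaf.map (homOfLE hUW).op f)
    (D.idealSheaf.ideal_le_comap_ideal (U := ⟨U, hU⟩) (V := W) hUW hf) x hxU
  refine ⟨W₁, h₁.trans hUW, hx₁, g₁, ?_⟩
  rw [e₁]
  simp only [← ConcreteCategory.comp_apply, ← Functor.map_comp]
  rfl

/-- `𝒪_X(D)` as a submodule of `j_* 𝒪_{X \ D}`. -/
def sheafSubmodule : PresheafOfModules.Submodule D.meromorphic.val where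
  obj V :=
    { carrier := {s | D.IsSectionOfSheaf V.unop s}
      add_mem' := fun hs ht => hs.add ht
      zero_mem' := D.isSectionOfSheaf_zero V.unop
      smul_mem' := fun a _ hs => hs.smul a }
  map i _ hs := hs.map (leOfHom i.unop)

/-- The invertible sheaf `𝒪_X(D)`. -/
def sheaf : X.Modules where
  val := D.sheafSubmodule.toPresheafOfModules
  isSheaf := by
    have hM := (Presheaf.isSheaf_iff_isSheaf_forget (Opens.grothendieckTopology X)
      D.meromorphic.presheaf (forget Ab)).mp D.meromorphic.isSheaf
    rw [isSheaf_iff_isSheaf_of_type] at hM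
    rw [Presheaf.isSheaf_iff_isSheaf_forget _ _ (forget Ab), isSheaf_iff_isSheaf_of_type]
    let G : Subfunctor (D.meromorphic.presheaf ⋙ forget Ab) :=
      { obj := fun V => {s | D.IsSectionOfSheaf V.unop s}
        map := fun i _ hs => IsSectionOfSheaf.map (leOfHom i.unop) hs }
    refine (Subfunctor.isSheaf_iff (G := G) hM).mpr ?_
    intro V s hs
    exact D.isSectionOfSheaf_of_locally V.unop s fun x hx => by
      obtain ⟨V', i, hi, hx'⟩ := hs x hx
      exact ⟨V', leOfHom i, hx', hi⟩

/-- The canonical map `𝒪_X ⟶ 𝒪_X(D)`. -/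
def toSheaf : structureModule X ⟶ D.sheaf where
  val := PresheafOfModules.homMk
    { app := fun V => AddCommGrpCat.ofHom
        { toFun := fun a => ⟨D.compl.ι.app V.unop a, D.isSectionOfSheaf_app V.unop a⟩
          map_zero' := Subtype.ext (map_zero (D.compl.ι.app V.unop).hom)
          map_add' := fun a b => Subtype.ext (map_add (D.compl.ι.app V.unop).hom a b) }
      naturality := fun V V' i => by
        ext a
        exact Subtype.ext (ι_app_map D (leOfHom i.unop) a) }
    (fun V r m => Subtype.ext (map_mul (D.compl.ι.app V.unop).hom r m))

end EffectiveCartierDivisor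

/-! ## Frobenius splittings -/

/-- `X` is Frobenius split: `𝒪_X ⟶ F_* 𝒪_X` splits as a map of `𝒪_X`-modules. -/
def IsFrobeniusSplit (X : Scheme.{u}) (p : ℕ) [Fact p.Prime] [IsSchemeInChar X p] : Prop :=
  IsSplitMono (toPushforwardStructureModule (absoluteFrobenius X p))

/-- `X` splits relative to `D`: the composition `𝒪_X ⟶ F_* 𝒪_X ⟶ F_* 𝒪_X(D)` splits as a map of
`𝒪_X`-modules. -/
def IsFrobeniusSplitRelativeTo (X : Scheme.{u}) (p : ℕ) [Fact p.Prime] [IsSchemeInChar X p]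
    (D : EffectiveCartierDivisor X) : Prop :=
  IsSplitMono (toPushforwardStructureModule (absoluteFrobenius X p) ≫
    (Scheme.Modules.pushforward (absoluteFrobenius X p)).map D.toSheaf)

end

/-!
The assertion is local, so let `R` be a stalk of `X`. As `X` is locally of finite type over a
regular ring, `R = S ⧸ I` for a regular local ring `S` whose localizations are again regular. Let
`f` be a local equation of `D` and `r` a retraction of `𝒪_X ⟶ F_* 𝒪_X(D)`. Then `ψ b = r (b / f)`
is an additive endomorphism of `R` with `ψ (a ^ p * b) = a * ψ b` and `ψ f = 1`, and `R_Q` is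
Cohen–Macaulay for the primes `Q` not containing `f`. The iterates of `ψ` allow to divide by
arbitrary powers of `f` at the cost of extracting `p ^ e`-th roots
(`exists_iterate_apply_pow_mul_eq_one`). This is used twice.

* *Equidimensionality.* Minimal primes of `R` below a common prime `Q` not containing `f` have the
  same dimension. If some minimal primes had dimension `dim R` and others had not, the
  intersections `𝔞` and `𝔟` of the two classes would satisfy `𝔞 𝔟 = 0` and `f ∈ √(𝔞 + 𝔟)`, and the
  splitting excludes this unless `𝔞 = 0` or `𝔟 = 0` (`eq_bot_or_eq_bot_of_mem_radical_sup`). Hence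
  all minimal primes of `I` have the same height `h = dim S - dim R`
  (`exists_forall_minimalPrimes_height_eq`).

* *Regular sequences.* By the Auslander–Buchsbaum formula, the localizations of `R` at the primes
  `Q` not containing `f` have projective dimension at most `h` over `S_Q`, so some power `f ^ N`
  factors through a free module on the `h`-th syzygy of `R` (`exists_pow_syzygyFactors`). Choose
  `y₁, …, y_h ∈ I` and a system of parameters `x₁, …, x_d` of `R` such that `y₁, …, y_h, x₁, …,
  x_d` is a system of parameters of `S`. For all `q` the sequences `x₁ ^ q, …, x_k ^ q, y₁, …,
  y_h` are regular on `S`, and the `y_j` annihilate `R`, so dimension shifting shows that `f ^ N`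
  annihilates `Tor₁(R, S ⧸ (x₁ ^ q, …, x_k ^ q))` (`SyzygyFactors.annihilatesTorOne`).
  Consequently `f ^ N` multiplies the colon ideals `(x₁ ^ q, …, x_k ^ q) : x_{k+1} ^ q` of `R`
  into `(x₁ ^ q, …, x_k ^ q)`, with `N` independent of `q`. Taking `q = p ^ e` with `e` large and
  applying an iterate of `ψ`, the sequence `x₁, …, x_d` is regular on `R`
  (`mem_ofList_of_forall_pow_mul_mem`).
-/

/-! ### Depth and dimension over a local ring -/

section

open IsLocalRing RingTheory.Sequence Module Pointwise

theorem ringKrullDim_quotient_le_supportDim_of_mem_support {S : Type u} [CommRing S]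
    {M : Type u} [AddCommGroup M] [Module S M] {P : PrimeSpectrum S} (hP : P ∈ support S M) :
    ringKrullDim (S ⧸ P.asIdeal) ≤ supportDim S M := by
  rw [← supportDim_quotient_eq_ringKrullDim]
  have hsub : support S (S ⧸ P.asIdeal) ⊆ support S M := by
    intro q hq
    rw [Module.support_eq_zeroLocus, Ideal.annihilator_quotient] at hq
    exact Module.mem_support_mono hq hP
  exact Order.krullDim_le_of_strictMono (fun q ↦ ⟨q.1, hsub q.2⟩) (fun _ _ h ↦ h)

variable {S : Type u} [CommRing S] [IsLocalRing S] [IsNoetherianRing S]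

/-- A regular sequence on `M` has length at most `dim S ⧸ P` for every associated prime `P` of `M`:
if `x` is `M`-regular, then `M ⧸ xM` has an associated prime containing `P` and `x`. -/
theorem length_le_ringKrullDim_quotient_of_isAssociatedPrime {M : Type u} [AddCommGroup M]
    [Module S M] [Module.Finite S M] {rs : List S} (hmem : ∀ r ∈ rs, r ∈ maximalIdeal S)
    (reg : IsWeaklyRegular M rs) {P : Ideal S} (hP : IsAssociatedPrime P M) :
    (rs.length : WithBot ℕ∞) ≤ ringKrullDim (S ⧸ P) := by
  induction rs generalizing M P with
  | nil =>
    have := hP.isPrime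
    simpa using ringKrullDim_nonneg_of_nontrivial
  | cons x rs ih =>
    have hPp := hP.isPrime
    obtain ⟨hx, hrs⟩ := (isWeaklyRegular_cons_iff M x rs).1 reg
    have hxm : x ∈ maximalIdeal S := hmem x (by simp)
    obtain ⟨-, u, hu⟩ := isAssociatedPrime_iff.1 hP
    have hu0 : u ≠ 0 := by
      rintro rfl
      exact hPp.ne_top (by rw [hu]; ext; simp [Submodule.mem_colon_singleton])
    have hxP : x ∉ P := by
      intro h
      rw [hu, Submodule.mem_colon_singleton, Submodule.mem_bot] at h
      exact hu0 (hx (by simpa using h))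
    -- by Nakayama's lemma, some element killed by `P` is not divisible by `x`; an associated prime
    -- of its annihilator in `M ⧸ xM` is the required one
    let N : Submodule S M := Submodule.torsionBySet S M P
    have hN : ∃ v ∈ N, v ∉ x • (⊤ : Submodule S M) := by
      by_contra! hcon
      have hle : N ≤ Ideal.span {x} • N := by
        intro v hv
        obtain ⟨w, -, rfl⟩ := (Submodule.mem_smul_pointwise_iff_exists _ _ _).1 (hcon v hv)
        refine Submodule.smul_mem_smul (Ideal.mem_span_singleton_self x) ?_
        rw [Submodule.mem_torsionBySet_iff] at hv ⊢
        intro a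
        refine hx ?_
        have := hv a
        simpa [smul_comm x] using this
      have hbot := Submodule.eq_bot_of_le_smul_of_le_jacobson_bot (Ideal.span {x}) N
        (IsNoetherian.noetherian N) hle (by
          rw [Ideal.span_singleton_le_iff_mem, IsLocalRing.jacobson_eq_maximalIdeal _ bot_ne_top]
          exact hxm)
      have huN : u ∈ N := by
        rw [Submodule.mem_torsionBySet_iff]
        rintro ⟨a, ha⟩
        have ha' : a ∈ P := ha
        rw [hu, Submodule.mem_colon_singleton, Submodule.mem_bot] at ha'
        exact ha'
      rw [hbot] at huN
      exact hu0 (by simpa using huN)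
    obtain ⟨v, hvN, hv⟩ := hN
    have hv0 : (Submodule.Quotient.mk v : QuotSMulTop x M) ≠ 0 := by
      rwa [Ne, Submodule.Quotient.mk_eq_zero]
    obtain ⟨P', hP', hle⟩ := exists_le_isAssociatedPrime_of_isNoetherianRing S _ hv0
    have hPP' : P ≤ P' := by
      intro a ha
      refine hle ?_
      rw [Submodule.mem_colon_singleton, Submodule.mem_bot, ← Submodule.Quotient.mk_smul]
      rw [Submodule.mem_torsionBySet_iff] at hvN
      rw [hvN ⟨a, ha⟩, Submodule.Quotient.mk_zero]
    have hxP' : x ∈ P' := by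
      refine hle ?_
      rw [Submodule.mem_colon_singleton, Submodule.mem_bot, ← Submodule.Quotient.mk_smul,
        Submodule.Quotient.mk_eq_zero]
      exact Submodule.smul_mem_pointwise_smul _ _ _ trivial
    have h1 := ih (fun r hr ↦ hmem r (by simp [hr])) hrs hP'
    have h2 : ringKrullDim (S ⧸ P') + 1 ≤ ringKrullDim (S ⧸ P) := by
      refine ringKrullDim_succ_le_of_surjective (Ideal.Quotient.factor hPP')
        (Ideal.Quotient.factor_surjective hPP') (r := Ideal.Quotient.mk P x) ?_ ?_
      · rw [mem_nonZeroDivisors_iff_ne_zero, Ne, Ideal.Quotient.eq_zero_iff_mem]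
        exact hxP
      · simpa [Ideal.Quotient.eq_zero_iff_mem] using hxP'
    rw [List.length_cons, Nat.cast_succ]
    exact (add_le_add_left h1 1).trans h2

variable (S) in
/-- `HasRegularSequence S M t` says that the depth of the module `M` over the local ring `S` is at
least `t`: the maximal ideal contains an `M`-regular sequence of length `t`. -/
def HasRegularSequence (M : Type u) [AddCommGroup M] [Module S M] (t : ℕ) : Prop :=
  ∃ rs : List S, rs.length = t ∧ (∀ r ∈ rs, r ∈ maximalIdeal S) ∧ IsRegular M rs

/-- The depth drops by at most one modulo a regular element, by the characterization of depth
through the vanishing of `Ext`. -/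
theorem HasRegularSequence.quotSMulTop {M : Type u} [AddCommGroup M] [Module S M]
    [Module.Finite S M] {t : ℕ} (h : HasRegularSequence S M (t + 1)) {x : S}
    (hx : x ∈ maximalIdeal S) (reg : IsSMulRegular M x) :
    HasRegularSequence S (QuotSMulTop x M) t := by
  have hnt : Nontrivial M := h.choose_spec.2.2.nontrivial
  have key (L : Type u) [AddCommGroup L] [Module S L] [Module.Finite S L] [Nontrivial L] :
      maximalIdeal S • (⊤ : Submodule S L) < ⊤ :=
    (Submodule.top_ne_ideal_smul_of_le_jacobson_annihilator
      (maximalIdeal_le_jacobson _)).symm.lt_top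
  have h1 := ((ModuleCat.exists_isRegular_tfae (maximalIdeal S) (t + 1) (ModuleCat.of S M)
    (key M)).out 1 3).2 h
  have := nontrivial_quotSMulTop_of_mem_maximalIdeal M hx
  refine ((ModuleCat.exists_isRegular_tfae (maximalIdeal S) t
    (ModuleCat.of S (QuotSMulTop x M)) (key (QuotSMulTop x M))).out 1 3).1 fun i hi ↦ ?_
  have zero1 := AddCommGrpCat.isZero_of_iff_subsingleton.mpr (h1 i (by omega))
  have zero2 := AddCommGrpCat.isZero_of_iff_subsingleton.mpr (h1 (i + 1) (by omega))
  exact AddCommGrpCat.subsingleton_of_isZero <| ShortComplex.Exact.isZero_of_both_zeros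
    ((Abelian.Ext.covariant_sequence_exact₃' _
      (IsSMulRegular.smulShortComplex_shortExact (M := ModuleCat.of S M) reg)) i (i + 1) rfl)
    (zero1.eq_zero_of_src _) (zero2.eq_zero_of_tgt _)

theorem supportDim_le_supportDim_quotient_add_length {M : Type u} [AddCommGroup M] [Module S M]
    [Module.Finite S M] {rs : List S} (hmem : ∀ r ∈ rs, r ∈ maximalIdeal S) :
    supportDim S M ≤ supportDim S (M ⧸ Ideal.ofList rs • (⊤ : Submodule S M)) + rs.length := by
  induction rs generalizing M with
  | nil =>
    rw [Ideal.ofList_nil, Submodule.bot_smul]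
    simpa using (supportDim_eq_of_equiv (Submodule.quotEquivOfEqBot (⊥ : Submodule S M) rfl)).ge
  | cons x rs ih =>
    rw [supportDim_eq_of_equiv (Submodule.quotOfListConsSMulTopEquivQuotSMulTopInner M x rs),
      List.length_cons, Nat.cast_succ, ← add_assoc]
    exact (supportDim_le_supportDim_quotSMulTop_succ (hmem x (by simp))).trans
      (add_le_add_left (ih fun r hr ↦ hmem r (by simp [hr])) 1)

/-- In a Cohen–Macaulay module, every system of parameters is a regular sequence. -/
theorem HasRegularSequence.isRegular_of_supportDim_quotient_le_zero {M : Type u} [AddCommGroup M]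
    [Module S M] [Module.Finite S M] {rs : List S} (h : HasRegularSequence S M rs.length)
    (hmem : ∀ r ∈ rs, r ∈ maximalIdeal S)
    (hdim : supportDim S (M ⧸ Ideal.ofList rs • (⊤ : Submodule S M)) ≤ 0) :
    IsRegular M rs := by
  induction rs generalizing M with
  | nil =>
    have : Nontrivial M := h.choose_spec.2.2.nontrivial
    exact .nil S M
  | cons x rs ih =>
    have hxm : x ∈ maximalIdeal S := hmem x (by simp)
    have hmem' : ∀ r ∈ rs, r ∈ maximalIdeal S := fun r hr ↦ hmem r (by simp [hr])
    rw [supportDim_eq_of_equiv (Submodule.quotOfListConsSMulTopEquivQuotSMulTopInner M x rs)]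
      at hdim
    have hdim' : supportDim S (QuotSMulTop x M) ≤ rs.length :=
      (supportDim_le_supportDim_quotient_add_length hmem').trans (by
        simpa using add_le_add_left hdim (rs.length : WithBot ℕ∞))
    -- if `x` were not regular, it would lie in an associated prime of `M`, whose dimension is at
    -- least the depth `rs.length + 1`, while `dim M ⧸ xM ≤ rs.length`
    have hx : IsSMulRegular M x := by
      by_contra hcon
      obtain ⟨v, hxv, hv⟩ : ∃ v : M, x • v = 0 ∧ v ≠ 0 := by
        rw [isSMulRegular_iff_right_eq_zero_of_smul] at hcon
        push Not at hcon
        exact hcon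
      obtain ⟨P, hP, hle⟩ := exists_le_isAssociatedPrime_of_isNoetherianRing S v hv
      have hxP : x ∈ P := hle (by rw [Submodule.mem_colon_singleton]; simpa using hxv)
      obtain ⟨ws, hlen, hws, hreg⟩ := h
      have h1 := length_le_ringKrullDim_quotient_of_isAssociatedPrime hws hreg.1 hP
      have hPs : (⟨P, hP.isPrime⟩ : PrimeSpectrum S) ∈ support S (QuotSMulTop x M) := by
        rw [Module.support_quotSMulTop]
        refine ⟨?_, by simpa using hxP⟩
        rw [Module.mem_support_iff_of_finite]
        rw [← Submodule.annihilator_top]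
        exact hP.annihilator_le
      have h2 := (ringKrullDim_quotient_le_supportDim_of_mem_support hPs).trans hdim'
      have h3 := h1.trans h2
      rw [hlen, List.length_cons] at h3
      norm_cast at h3
      omega
    exact .cons hx (ih (h.quotSMulTop hxm hx) hmem' hdim)

end

/-! ### Regular sequences in regular local rings -/

section

open IsLocalRing RingTheory.Sequence Module Pointwise

/-- Modulo an element of `𝔪 \ 𝔪²`, the maximal ideal needs one generator less. -/
theorem spanFinrank_maximalIdeal_quotient_add_one_le {S : Type u} [CommRing S] [IsLocalRing S]
    [IsNoetherianRing S] {x : S} (hx : x ∈ maximalIdeal S) (hx2 : x ∉ maximalIdeal S ^ 2)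
    [IsLocalRing (S ⧸ Ideal.span {x})] :
    (maximalIdeal (S ⧸ Ideal.span {x})).spanFinrank + 1 ≤ (maximalIdeal S).spanFinrank := by
  let c : maximalIdeal S → CotangentSpace S := (maximalIdeal S).toCotangent
  let x' : maximalIdeal S := ⟨x, hx⟩
  -- extend the class of `x` to a basis `B` of the cotangent space and lift it to generators
  have hx0 : c x' ≠ 0 := fun h ↦ hx2 (((maximalIdeal S).toCotangent_eq_zero x').1 h)
  have hli : LinearIndepOn (ResidueField S) id {c x'} := .singleton hx0
  let B : Set (CotangentSpace S) := hli.extend (Set.subset_univ _)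
  have hxB : c x' ∈ B := hli.subset_extend (Set.subset_univ _) rfl
  have hBspan : Submodule.span (ResidueField S) B = ⊤ := by
    have := hli.span_extend_eq_span (Set.subset_univ _)
    simpa using this
  have hBli : LinearIndepOn (ResidueField S) id B := hli.linearIndepOn_extend (Set.subset_univ _)
  have hBfin : B.Finite := hBli.finite
  have hBcard : B.ncard ≤ finrank (ResidueField S) (CotangentSpace S) := by
    have := hBfin.fintype
    have h := hBli.linearIndependent.fintype_card_le_finrank
    rwa [← Nat.card_eq_fintype_card, Nat.card_coe_set_eq] at h
  have hsurj : Function.Surjective c := (maximalIdeal S).toCotangent_surjective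
  classical
  let g : CotangentSpace S → maximalIdeal S :=
    Function.update (Function.surjInv hsurj) (c x') x'
  have hg : ∀ v, c (g v) = v := by
    intro v
    by_cases hv : v = c x'
    · subst hv; simp [g]
    · simp [g, Function.update_of_ne hv, Function.surjInv_eq]
  have hgspan : Submodule.span S (g '' B) = ⊤ := by
    rw [← CotangentSpace.span_image_eq_top_iff, ← hBspan]
    congr 1
    rw [← Set.image_comp]
    exact (Set.image_congr fun v _ ↦ hg v).trans (Set.image_id B)
  have hm : maximalIdeal S = Ideal.span ((fun y : maximalIdeal S ↦ (y : S)) '' (g '' B)) := by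
    have := congrArg (Submodule.map (maximalIdeal S).subtype) hgspan
    rw [Submodule.map_span, Submodule.map_top, Submodule.range_subtype] at this
    exact this.symm
  let q := Ideal.Quotient.mk (Ideal.span {x})
  have hmq : maximalIdeal (S ⧸ Ideal.span {x}) = (maximalIdeal S).map q :=
    (IsLocalRing.map_maximalIdeal_of_surjective q Ideal.Quotient.mk_surjective).symm
  have hmq' : maximalIdeal (S ⧸ Ideal.span {x}) =
      Ideal.span ((fun v ↦ q (g v)) '' (B \ {c x'})) := by
    rw [hmq]
    refine (congrArg (Ideal.map q) hm).trans ?_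
    rw [Ideal.map_span, ← Set.image_comp, ← Set.image_comp]
    refine le_antisymm (Ideal.span_le.2 ?_) (Ideal.span_mono (Set.image_mono Set.sdiff_subset))
    rintro _ ⟨v, hv, rfl⟩
    by_cases hvx : v = c x'
    · have : q (g v : S) = 0 := by
        subst hvx
        simp [g, q, x']
      simp [this]
    · exact Ideal.subset_span ⟨v, ⟨hv, hvx⟩, rfl⟩
  rw [spanFinrank_maximalIdeal_eq_finrank_cotangentSpace S]
  refine le_trans ?_ hBcard
  rw [← Set.ncard_sdiff_singleton_add_one hxB hBfin, hmq']
  gcongr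
  exact (Submodule.spanFinrank_span_le_ncard_of_finite ((hBfin.sdiff).image _)).trans
    (Set.ncard_image_le hBfin.sdiff)

/-- A regular local ring is a domain whose maximal ideal is generated by a regular sequence of
length the dimension. -/
theorem IsRegularLocalRing.isDomain_and_exists_isRegular (n : ℕ) (S : Type u) [CommRing S]
    [IsRegularLocalRing S] (hn : ringKrullDim S = n) :
    IsDomain S ∧ ∃ rs : List S, rs.length = n ∧ Ideal.ofList rs = maximalIdeal S ∧
      IsRegular S rs := by
  induction n generalizing S with
  | zero =>
    have hfield : maximalIdeal S = ⊥ := by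
      have h := IsRegularLocalRing.spanFinrank_maximalIdeal (R := S)
      rw [hn] at h
      have h' : (maximalIdeal S).spanFinrank = 0 := by exact_mod_cast h
      exact (Submodule.spanFinrank_eq_zero_iff_eq_bot
        (IsNoetherian.noetherian (maximalIdeal S))).1 h'
    refine ⟨?_, [], rfl, by simp [hfield], .nil S S⟩
    exact (IsLocalRing.isField_iff_maximalIdeal_eq.2 hfield).isDomain
  | succ n ih =>
    have hheight : (maximalIdeal S).height = (n + 1 : ℕ) := by
      have := maximalIdeal_height_eq_ringKrullDim (R := S)
      rw [hn] at this
      exact_mod_cast this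
    -- prime avoidance, which allows the ideal `𝔪 ^ 2` to be not prime
    obtain ⟨x, hx, hx2, hxmin⟩ : ∃ x ∈ maximalIdeal S, x ∉ maximalIdeal S ^ 2 ∧
        ∀ P ∈ minimalPrimes S, x ∉ P := by
      by_contra! hcon
      have hfin : (insert (maximalIdeal S ^ 2) (minimalPrimes S)).Finite :=
        (minimalPrimes.finite_of_isNoetherianRing S).insert _
      obtain ⟨J, hJ, hle⟩ := (Ideal.subset_union_prime_finite hfin (f := id)
        (maximalIdeal S ^ 2) (maximalIdeal S ^ 2)
        (fun J hJ hne _ ↦ ((Set.mem_insert_iff.1 hJ).resolve_left hne).1.1)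
        (I := maximalIdeal S)).1 (by
          intro y hy
          by_cases hy2 : y ∈ maximalIdeal S ^ 2
          · exact Set.mem_biUnion (Set.mem_insert _ _) hy2
          · obtain ⟨P, hP, hyP⟩ := hcon y hy hy2
            exact Set.mem_biUnion (Set.mem_insert_of_mem _ hP) hyP)
      rcases Set.mem_insert_iff.1 hJ with rfl | hJ
      · have hbot := Submodule.eq_bot_of_le_smul_of_le_jacobson_bot (maximalIdeal S)
          (maximalIdeal S) (IsNoetherian.noetherian _) (by rwa [smul_eq_mul, ← pow_two])
          (maximalIdeal_le_jacobson _)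
        rw [hbot, Ideal.height_bot] at hheight
        norm_cast at hheight
      · have := hJ.1.1
        have h0 := Ideal.height_eq_zero_iff.2 hJ
        have h1 := Ideal.height_mono hle
        rw [hheight, id, h0] at h1
        norm_cast at h1
    have hne : Ideal.span {x} ≠ ⊤ := fun h ↦ (maximalIdeal.isMaximal S).ne_top
      (top_le_iff.1 (h ▸ (Ideal.span_singleton_le_iff_mem _).2 hx))
    have := Ideal.Quotient.nontrivial_iff.2 hne
    have hloc : IsLocalRing (S ⧸ Ideal.span {x}) :=
      .of_surjective' (Ideal.Quotient.mk _) Ideal.Quotient.mk_surjective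
    have hrank : (maximalIdeal (S ⧸ Ideal.span {x})).spanFinrank ≤ n := by
      have h := spanFinrank_maximalIdeal_quotient_add_one_le hx hx2
      have h' := IsRegularLocalRing.spanFinrank_maximalIdeal (R := S)
      rw [hn] at h'
      have h'' : (maximalIdeal S).spanFinrank = n + 1 := by exact_mod_cast h'
      omega
    have hdim : (n : WithBot ℕ∞) ≤ ringKrullDim (S ⧸ Ideal.span {x}) := by
      have h := ringKrullDim_le_ringKrullDim_quotSMulTop_succ hx
      rw [hn, ← Submodule.ideal_span_singleton_smul, smul_eq_mul, Ideal.mul_top,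
        Nat.cast_succ] at h
      exact (ENat.WithBot.add_le_add_one_right_iff).1 h
    have hreg : IsRegularLocalRing (S ⧸ Ideal.span {x}) :=
      .of_spanFinrank_maximalIdeal_le _ ((Nat.cast_le.2 hrank).trans hdim)
    have hdim' : ringKrullDim (S ⧸ Ideal.span {x}) = n :=
      le_antisymm (IsRegularLocalRing.spanFinrank_maximalIdeal (R := S ⧸ Ideal.span {x}) ▸
        Nat.cast_le.2 hrank) hdim
    obtain ⟨hdom, rs', hlen, hspan, hrs'⟩ := ih (S ⧸ Ideal.span {x}) hdim'
    have hprime : (Ideal.span {x}).IsPrime := (Ideal.Quotient.isDomain_iff_prime _).1 hdom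
    -- a minimal prime `P ≤ (x)` satisfies `P = x P`, so it vanishes by Nakayama's lemma
    have hS : IsDomain S := by
      obtain ⟨P, hP, hle⟩ := Ideal.exists_minimalPrimes_le (bot_le : ⊥ ≤ Ideal.span {x})
      have hPprime := hP.1.1
      have hbot := Submodule.eq_bot_of_le_smul_of_le_jacobson_bot (maximalIdeal S) P
        (IsNoetherian.noetherian _) (by
          intro a ha
          obtain ⟨b, rfl⟩ := Ideal.mem_span_singleton.1 (hle ha)
          exact Ideal.mul_mem_mul hx ((hPprime.mem_or_mem ha).resolve_left (hxmin P hP)))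
        (maximalIdeal_le_jacobson _)
      subst hbot
      exact (IsDomain.of_bot_isPrime S)
    refine ⟨hS, ?_⟩
    have hx0 : x ≠ 0 := by
      rintro rfl
      exact hx2 (zero_mem _)
    obtain ⟨rs, rfl⟩ := List.map_surjective_iff.2 (Ideal.Quotient.mk_surjective
      (I := Ideal.span {x})) rs'
    refine ⟨x :: rs, by simpa using hlen, ?_, ?_⟩
    · rw [← Ideal.map_ofList] at hspan
      have h := congrArg (Ideal.comap (Ideal.Quotient.mk (Ideal.span {x}))) hspan
      rw [Ideal.comap_map_of_surjective _ Ideal.Quotient.mk_surjective,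
        ← RingHom.ker_eq_comap_bot, Ideal.mk_ker] at h
      rw [Ideal.ofList_cons, sup_comm, h]
      exact ((local_hom_TFAE (Ideal.Quotient.mk (Ideal.span {x}))).out 0 4).1
        (IsLocalHom.of_surjective _ Ideal.Quotient.mk_surjective)
    · refine .cons (IsSMulRegular.of_ne_zero hx0) ?_
      have e : QuotSMulTop x S ≃ₗ[S] S ⧸ Ideal.span {x} :=
        Submodule.quotEquivOfEq _ _ (by
          rw [← Submodule.ideal_span_singleton_smul, smul_eq_mul, Ideal.mul_top])
      have hw := (isWeaklyRegular_map_algebraMap_iff (S := S ⧸ Ideal.span {x})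
        (M := S ⧸ Ideal.span {x}) rs).1 hrs'.1
      have := e.toEquiv.nontrivial
      refine .of_isWeaklyRegular_of_mem_maximalIdeal _ (fun r hr ↦ ?_)
        ((e.isWeaklyRegular_congr rs).2 hw)
      have hr' : Ideal.Quotient.mk (Ideal.span {x}) r ∈ maximalIdeal (S ⧸ Ideal.span {x}) :=
        hspan ▸ Ideal.subset_span (List.mem_map_of_mem hr)
      rw [mem_maximalIdeal] at hr' ⊢
      exact fun hu ↦ hr' (hu.map _)

theorem IsRegularLocalRing.hasRegularSequence {S : Type u} [CommRing S] [IsRegularLocalRing S]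
    {n : ℕ} (hn : ringKrullDim S = n) : HasRegularSequence S S n := by
  obtain ⟨-, rs, hlen, hspan, hreg⟩ := IsRegularLocalRing.isDomain_and_exists_isRegular n S hn
  exact ⟨rs, hlen, fun r hr ↦ hspan ▸ Ideal.subset_span hr, hreg⟩

section

variable {S : Type u} [CommRing S] [IsLocalRing S] [IsNoetherianRing S]

/-- If `M` has depth `n`, then an ideal `I` contains a regular sequence of length
`n - dim S ⧸ I`. -/
theorem HasRegularSequence.exists_isRegular_mem {M : Type u} [AddCommGroup M] [Module S M]
    [Module.Finite S M] {n h d : ℕ} (hM : HasRegularSequence S M n) {I : Ideal S}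
    (hI : I ≤ maximalIdeal S) (hd : ringKrullDim (S ⧸ I) ≤ d) (hle : h + d ≤ n) :
    ∃ ys : List S, ys.length = h ∧ (∀ y ∈ ys, y ∈ I) ∧ IsRegular M ys := by
  induction h generalizing M n with
  | zero =>
    have : Nontrivial M := hM.choose_spec.2.2.nontrivial
    exact ⟨[], rfl, by simp, .nil S M⟩
  | succ h ih =>
    obtain ⟨n, rfl⟩ : ∃ k, n = k + 1 := ⟨n - 1, by omega⟩
    -- otherwise `I` lies in an associated prime `P`, and the depth is at most `dim S ⧸ P`
    obtain ⟨y, hyI, hy⟩ : ∃ y ∈ I, IsSMulRegular M y := by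
      by_contra! hcon
      obtain ⟨P, hP, hIP⟩ := (Ideal.subset_union_prime_finite (associatedPrimes.finite S M)
        (f := id) ⊥ ⊥ (fun P hP _ _ ↦ hP.isPrime) (I := I)).1 (by
          simp only [id]
          rw [biUnion_associatedPrimes_eq_zero_divisors]
          intro y hy
          have := hcon y hy
          rw [isSMulRegular_iff_right_eq_zero_of_smul] at this
          push Not at this
          obtain ⟨v, h1, h2⟩ := this
          exact ⟨v, h2, h1⟩)
      obtain ⟨ws, hlen, hws, hreg⟩ := hM
      have h1 := length_le_ringKrullDim_quotient_of_isAssociatedPrime hws hreg.1 hP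
      have h2 := (h1.trans (ringKrullDim_le_of_surjective (Ideal.Quotient.factor hIP)
        (Ideal.Quotient.factor_surjective hIP))).trans hd
      rw [hlen] at h2
      norm_cast at h2
      omega
    obtain ⟨ys, hlen, hys, hreg⟩ := ih (hM.quotSMulTop (hI hyI) hy) (by omega)
    exact ⟨y :: ys, by simpa using hlen, by simpa using ⟨hyI, hys⟩, .cons hy hreg⟩

/-- In a Cohen–Macaulay local ring, every list of `dim S` elements generating an ideal which is
primary to the maximal ideal is a regular sequence. -/
theorem HasRegularSequence.isRegular_of_maximalIdeal_le_radical {rs : List S}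
    (h : HasRegularSequence S S rs.length) (hmem : ∀ r ∈ rs, r ∈ maximalIdeal S)
    (hrad : maximalIdeal S ≤ (Ideal.ofList rs).radical) : IsRegular S rs := by
  refine h.isRegular_of_supportDim_quotient_le_zero hmem ?_
  rw [smul_eq_mul, Ideal.mul_top, supportDim_quotient_eq_ringKrullDim]
  rw [← Nat.cast_zero, ← Ring.krullDimLE_iff, Ring.krullDimLE_zero_iff]
  intro J hJ
  have hmax : maximalIdeal S ≤ J.comap (Ideal.Quotient.mk (Ideal.ofList rs)) := by
    refine hrad.trans ?_
    have := hJ.comap (Ideal.Quotient.mk (Ideal.ofList rs))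
    refine this.radical_le_iff.2 fun a ha ↦ ?_
    simp [Ideal.Quotient.eq_zero_iff_mem.2 ha]
  have heq : J.comap (Ideal.Quotient.mk (Ideal.ofList rs)) = maximalIdeal S :=
    ((maximalIdeal.isMaximal S).eq_of_le (hJ.comap _).ne_top hmax).symm
  rw [← Ideal.map_comap_of_surjective _ Ideal.Quotient.mk_surjective J, heq]
  have hm := maximalIdeal.isMaximal S
  refine (Ideal.map_eq_top_or_isMaximal_of_surjective _ Ideal.Quotient.mk_surjective
    hm).resolve_left fun htop ↦ hJ.ne_top ?_
  rw [← heq, Ideal.map_comap_of_surjective _ Ideal.Quotient.mk_surjective] at htop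
  exact htop
end

end

/-! ### Dimension formula and projective dimension over regular local rings -/

section

open IsLocalRing RingTheory.Sequence Module Pointwise

/-- A nonzero finite module over a local ring is Cohen–Macaulay if its depth is the dimension of
its support. -/
def IsCohenMacaulayModule (S : Type u) [CommRing S] [IsLocalRing S] (M : Type u) [AddCommGroup M]
    [Module S M] : Prop :=
  ∃ t : ℕ, HasRegularSequence S M t ∧ supportDim S M = t

theorem exists_ringKrullDim_eq_natCast (S : Type u) [CommRing S] [IsLocalRing S]
    [IsNoetherianRing S] : ∃ n : ℕ, ringKrullDim S = n := by
  have h1 := ringKrullDim_ne_bot (R := S)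
  have h2 := ringKrullDim_ne_top (R := S)
  generalize ringKrullDim S = a at h1 h2
  induction a with
  | bot => exact absurd rfl h1
  | coe a =>
    induction a with
    | top => exact absurd rfl h2
    | coe n => exact ⟨n, rfl⟩

theorem height_add_ringKrullDim_quotient_le {S : Type u} [CommRing S] (P : Ideal S) [P.IsPrime] :
    (P.height : WithBot ℕ∞) + ringKrullDim (S ⧸ P) ≤ ringKrullDim S := by
  let P' : PrimeSpectrum S := ⟨P, ‹_›⟩
  have : Nonempty (PrimeSpectrum S) := ⟨P'⟩
  have h1 : ringKrullDim (S ⧸ P) = Order.coheight P' := by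
    rw [ringKrullDim_quotient, Order.coheight_eq_krullDim_Ici]
    congr 1
  rw [h1, ringKrullDim, Order.krullDim_eq_iSup_height_add_coheight_of_nonempty,
    ← WithBot.coe_add, WithBot.coe_le_coe,
    show P.height = Order.height P' from PrimeSpectrum.height_eq_orderHeight P']
  exact le_iSup (fun a : PrimeSpectrum S ↦ Order.height a + Order.coheight a) P'

/-- The dimension formula in a regular local ring. -/
theorem IsRegularLocalRing.ringKrullDim_eq_height_add {S : Type u} [CommRing S]
    [IsRegularLocalRing S] (P : Ideal S) [P.IsPrime] :
    ringKrullDim S = P.height + ringKrullDim (S ⧸ P) := by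
  refine le_antisymm ?_ (height_add_ringKrullDim_quotient_le P)
  obtain ⟨n, hn⟩ : ∃ n : ℕ, ringKrullDim S = n := exists_ringKrullDim_eq_natCast _
  have : IsLocalRing (S ⧸ P) := .of_surjective' (Ideal.Quotient.mk _) Ideal.Quotient.mk_surjective
  obtain ⟨d, hd⟩ : ∃ n : ℕ, ringKrullDim (S ⧸ P) = n := exists_ringKrullDim_eq_natCast _
  have hdn : d ≤ n := by
    have := ringKrullDim_quotient_le P
    rw [hn, hd] at this
    exact_mod_cast this
  -- a regular sequence in `P` of length `dim S - dim S ⧸ P` bounds the height from below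
  obtain ⟨ys, hlen, hys, hreg⟩ := (IsRegularLocalRing.hasRegularSequence hn).exists_isRegular_mem
    (I := P) (h := n - d) (d := d) (le_maximalIdeal ‹P.IsPrime›.ne_top) hd.le (by omega)
  have hreg' := hreg.1.isRegular_of_isLocalization_of_mem (Localization.AtPrime P) P hys
  have h := ringKrullDim_add_length_eq_ringKrullDim_of_isRegular _ hreg'
  rw [IsLocalization.AtPrime.ringKrullDim_eq_height P (Localization.AtPrime P), List.length_map,
    hlen] at h
  have := hreg'.quot_ofList_smul_nontrivial ⊤
  rw [smul_eq_mul, Ideal.mul_top] at this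
  have h0 : ((n - d : ℕ) : WithBot ℕ∞) ≤ P.height := by
    rw [← h]
    simpa using add_le_add_left (ringKrullDim_nonneg_of_nontrivial (R := Localization.AtPrime P ⧸
      Ideal.ofList (ys.map (algebraMap S (Localization.AtPrime P))))) ((n - d : ℕ) : WithBot ℕ∞)
  rw [hn, hd]
  calc (n : WithBot ℕ∞) = ((n - d : ℕ) : WithBot ℕ∞) + (d : WithBot ℕ∞) := by
        rw [← Nat.cast_add]; congr 1; omega
    _ ≤ _ := add_le_add_left h0 _

/-- Over a regular local ring of dimension `n`, modules of finite length have projective dimension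
at most `n`. -/
theorem IsRegularLocalRing.hasProjectiveDimensionLE_of_support_subset {S : Type u} [CommRing S]
    [IsRegularLocalRing S] {n : ℕ} (hn : ringKrullDim S = n) {M : Type u} [AddCommGroup M]
    [Module S M] [hfin : Module.Finite S M] (hM : support S M ⊆ {closedPoint S}) :
    HasProjectiveDimensionLE (ModuleCat.of S M) n := by
  obtain ⟨-, rs, hlen, hspan, hreg⟩ := IsRegularLocalRing.isDomain_and_exists_isRegular n S hn
  induction hfin using IsNoetherianRing.induction_on_isQuotientEquivQuotientPrime S with
  | subsingleton N =>
    have := (ModuleCat.isZero_of_subsingleton (ModuleCat.of S N)).hasProjectiveDimensionLT_zero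
    exact hasProjectiveDimensionLT_of_ge _ 0 _ (Nat.zero_le _)
  | quotient N p e =>
    have hp : p = closedPoint S := by
      refine hM ?_
      rw [e.support_eq, Module.support_eq_zeroLocus, Ideal.annihilator_quotient]
      exact Set.Subset.refl (p.asIdeal : Set S)
    have h1 := ModuleCat.projectiveDimension_quotient_eq_add_length_of_isWeaklyRegular
      (ModuleCat.of S S) rs hreg.1 (fun r hr ↦ hspan ▸ Ideal.subset_span hr)
    rw [ModuleCat.projectiveDimension_eq_zero_of_projective (ModuleCat.of S S), zero_add,
      hlen] at h1
    have h2 := (projectiveDimension_le_iff _ _).1 h1.le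
    have e' : (S ⧸ Ideal.ofList rs • (⊤ : Submodule S S)) ≃ₗ[S] N :=
      (Submodule.quotEquivOfEq _ _ (by
        rw [smul_eq_mul, Ideal.mul_top, hspan, hp]; rfl)).trans e.symm
    exact hasProjectiveDimensionLT_of_iso e'.toModuleIso _
  | exact N₁ N₂ N₃ f g hf hg hfg h₁ h₃ =>
    have hS : (ShortComplex.mk (ModuleCat.ofHom f) (ModuleCat.ofHom g)
      (ModuleCat.hom_ext hfg.linearMap_comp_eq_zero)).ShortExact :=
      { exact := (ShortComplex.ShortExact.moduleCat_exact_iff_function_exact _).2 hfg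
        mono_f := (ModuleCat.mono_iff_injective _).2 hf
        epi_g := (ModuleCat.epi_iff_surjective _).2 hg }
    exact hS.hasProjectiveDimensionLT_X₂ _
      (h₁ ((Module.support_subset_of_injective f hf).trans hM))
      (h₃ ((Module.support_subset_of_surjective g hg).trans hM))

/-- A Cohen–Macaulay module over a regular local ring has projective dimension at most its
codimension. -/
theorem IsRegularLocalRing.hasProjectiveDimensionLE {S : Type u} [CommRing S]
    [IsRegularLocalRing S] {M : Type u} [AddCommGroup M] [Module S M] [Module.Finite S M] {t h : ℕ}
    (hM : HasRegularSequence S M t) (ht : supportDim S M = t)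
    (hn : ringKrullDim S = (h + t : ℕ)) : HasProjectiveDimensionLE (ModuleCat.of S M) h := by
  obtain ⟨rs, hlen, hmem, hreg⟩ := hM
  have hnt := hreg.nontrivial
  have hdim := supportDim_add_length_eq_supportDim_of_isRegular rs hreg
  rw [ht, hlen] at hdim
  have hzero : supportDim S (M ⧸ Ideal.ofList rs • (⊤ : Submodule S M)) = 0 := by
    have : supportDim S (M ⧸ Ideal.ofList rs • (⊤ : Submodule S M)) + (t : ℕ) = 0 + (t : ℕ) := by
      rw [hdim, zero_add]
    exact le_antisymm ((ENat.WithBot.add_le_add_natCast_right_iff).1 this.le)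
      ((ENat.WithBot.add_le_add_natCast_right_iff).1 this.ge)
  have hsupp := (support_of_supportDim_eq_zero S _ hzero).le
  have hpd := IsRegularLocalRing.hasProjectiveDimensionLE_of_support_subset hn
    (M := M ⧸ Ideal.ofList rs • (⊤ : Submodule S M)) (hsupp.trans fun p hp ↦
      PrimeSpectrum.ext (le_antisymm (le_maximalIdeal p.2.ne_top) hp))
  rw [← projectiveDimension_le_iff] at hpd ⊢
  have h1 := ModuleCat.projectiveDimension_quotient_eq_add_length_of_isWeaklyRegular
      (ModuleCat.of S M) rs hreg.1 hmem
  rw [h1, hlen, Nat.cast_add] at hpd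
  exact (ENat.WithBot.add_le_add_natCast_right_iff).1 hpd

end

/-! ### Uniform annihilation of `Tor` -/

section

open IsLocalRing RingTheory.Sequence Module Pointwise

section

variable {S : Type u} [CommRing S] {M : Type u} [AddCommGroup M] [Module S M]

theorem mem_ideal_smul_top_pi_iff {k : ℕ} {𝔞 : Ideal S} {u : Fin k → S} :
    u ∈ 𝔞 • (⊤ : Submodule S (Fin k → S)) ↔ ∀ i, u i ∈ 𝔞 := by
  refine ⟨fun hu i ↦ ?_, fun hu ↦ ?_⟩
  · have h := Submodule.mem_map_of_mem (f := LinearMap.proj (R := S) (φ := fun _ : Fin k ↦ S) i) hu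
    rw [Submodule.map_smul''] at h
    have h' := (smul_mono_right 𝔞 le_top : _ ≤ 𝔞 • (⊤ : Submodule S S)) h
    rwa [smul_eq_mul, Ideal.mul_top] at h'
  · rw [pi_eq_sum_univ' u]
    exact Submodule.sum_mem _ fun i _ ↦ Submodule.smul_mem_smul (hu i) trivial

/-- Multiplication by `c` on `M` factors through a finite free module. Then `c` acts as zero on
`Extⁱ(M, -)` and `Torᵢ(M, -)` for all `i > 0`. -/
def FactorsThroughFree (c : S) (M : Type u) [AddCommGroup M] [Module S M] : Prop :=
  ∃ (k : ℕ) (α : M →ₗ[S] (Fin k → S)) (β : (Fin k → S) →ₗ[S] M), β ∘ₗ α = c • LinearMap.id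

/-- If `c` factors through a free module on `M`, then on a presentation `π : G → M` the
multiplication by `c` on the relations extends to all of `G`. -/
theorem FactorsThroughFree.exists_extension_to_ker {c : S} (h : FactorsThroughFree c M) {k : ℕ}
    {π : (Fin k → S) →ₗ[S] M} (hπ : Function.Surjective π) :
    ∃ γ : (Fin k → S) →ₗ[S] LinearMap.ker π, ∀ u : LinearMap.ker π, γ u = c • u := by
  obtain ⟨l, α, β, hαβ⟩ := h
  obtain ⟨β', hβ'⟩ := Module.projective_lifting_property π β hπ
  refine ⟨LinearMap.codRestrict _ (c • LinearMap.id - β' ∘ₗ α ∘ₗ π) fun g ↦ ?_, fun u ↦ ?_⟩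
  · have h1 : π (β' (α (π g))) = c • π g := by
      rw [← LinearMap.comp_apply, hβ', ← LinearMap.comp_apply, hαβ]; simp
    simp [h1]
  · ext1
    simp [LinearMap.mem_ker.1 u.2]

theorem FactorsThroughFree.ker {c : S} (h : FactorsThroughFree c M) {k : ℕ}
    {π : (Fin k → S) →ₗ[S] M} (hπ : Function.Surjective π) :
    FactorsThroughFree c (LinearMap.ker π) := by
  obtain ⟨γ, hγ⟩ := h.exists_extension_to_ker hπ
  exact ⟨k, (LinearMap.ker π).subtype, γ, LinearMap.ext hγ⟩

/-- `c` annihilates `Tor₁(M, S ⧸ 𝔞)`, computed as `(ker π ∩ 𝔞 G) / 𝔞 (ker π)` from a presentation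
`π : G → M`. -/
def AnnihilatesTorOne (c : S) {k : ℕ} (π : (Fin k → S) →ₗ[S] M) (𝔞 : Ideal S) : Prop :=
  ∀ u : LinearMap.ker π, (u : Fin k → S) ∈ 𝔞 • (⊤ : Submodule S (Fin k → S)) →
    c • u ∈ 𝔞 • (⊤ : Submodule S (LinearMap.ker π))

theorem map_mem_ideal_smul_top {N N' : Type u} [AddCommGroup N] [Module S N] [AddCommGroup N']
    [Module S N'] (φ : N →ₗ[S] N') {𝔞 : Ideal S} {u : N} (hu : u ∈ 𝔞 • (⊤ : Submodule S N)) :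
    φ u ∈ 𝔞 • (⊤ : Submodule S N') := by
  have h := Submodule.mem_map_of_mem (f := φ) hu
  rw [Submodule.map_smul''] at h
  exact (smul_mono_right 𝔞 le_top : _ ≤ 𝔞 • (⊤ : Submodule S N')) h

theorem FactorsThroughFree.annihilatesTorOne {c : S} (h : FactorsThroughFree c M) {k : ℕ}
    {π : (Fin k → S) →ₗ[S] M} (hπ : Function.Surjective π) (𝔞 : Ideal S) :
    AnnihilatesTorOne c π 𝔞 := by
  obtain ⟨γ, hγ⟩ := h.exists_extension_to_ker hπ
  intro u hu
  rw [← hγ]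
  exact map_mem_ideal_smul_top γ hu

/-- Annihilation of `Tor₁` does not depend on the presentation. -/
theorem AnnihilatesTorOne.of_presentation {c : S} {k l : ℕ} {π : (Fin k → S) →ₗ[S] M}
    {π' : (Fin l → S) →ₗ[S] M} {𝔞 : Ideal S} (h : AnnihilatesTorOne c π 𝔞)
    (hπ : Function.Surjective π) (hπ' : Function.Surjective π') : AnnihilatesTorOne c π' 𝔞 := by
  obtain ⟨φ, hφ⟩ := Module.projective_lifting_property π π' hπ
  obtain ⟨ψ, hψ⟩ := Module.projective_lifting_property π' π hπ'
  have hφ' (g) : π (φ g) = π' g := LinearMap.congr_fun hφ g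
  have hψ' (g) : π' (ψ g) = π g := LinearMap.congr_fun hψ g
  let δ : (Fin l → S) →ₗ[S] LinearMap.ker π' :=
    LinearMap.codRestrict _ (LinearMap.id - ψ ∘ₗ φ) fun g ↦ by simp [hψ', hφ']
  let ψ₀ : LinearMap.ker π →ₗ[S] LinearMap.ker π' :=
    ψ.restrict fun g hg ↦ by simpa [hψ'] using hg
  let φ₀ : LinearMap.ker π' →ₗ[S] LinearMap.ker π :=
    φ.restrict fun g hg ↦ by simpa [hφ'] using hg
  intro u hu
  have h1 : ψ₀ (c • φ₀ u) ∈ 𝔞 • (⊤ : Submodule S (LinearMap.ker π')) :=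
    map_mem_ideal_smul_top ψ₀ (h (φ₀ u) (map_mem_ideal_smul_top φ hu))
  have h2 : c • δ u ∈ 𝔞 • (⊤ : Submodule S (LinearMap.ker π')) :=
    Submodule.smul_mem _ _ (map_mem_ideal_smul_top δ hu)
  have : c • u = ψ₀ (c • φ₀ u) + c • δ u := by
    ext1
    simp [ψ₀, φ₀, δ, smul_sub]
  rw [this]
  exact add_mem h1 h2

/-- `SyzygyFactors c n M` says that on some `n`-th syzygy of `M` the multiplication by `c` factors
through a free module. -/
inductive SyzygyFactors (c : S) : ℕ → ∀ (M : Type u) [AddCommGroup M] [Module S M], Prop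
  | zero (M : Type u) [AddCommGroup M] [Module S M] (h : FactorsThroughFree c M) :
      SyzygyFactors c 0 M
  | succ (n : ℕ) (M : Type u) [AddCommGroup M] [Module S M] (k : ℕ) (π : (Fin k → S) →ₗ[S] M)
      (hπ : Function.Surjective π) (h : SyzygyFactors c n (LinearMap.ker π)) :
      SyzygyFactors c (n + 1) M

/-- The step of the dimension shift: a nonzerodivisor `y` on `S ⧸ 𝔞` which acts as zero on the
`Tor` groups of `M` turns annihilation of `Tor₁` of the syzygy modulo `(𝔞, y)` into annihilation of
`Tor₁(M, S ⧸ 𝔞)`. -/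
theorem AnnihilatesTorOne.of_ker {c y : S} {k l : ℕ} {π : (Fin k → S) →ₗ[S] M}
    (hπ : Function.Surjective π) {π' : (Fin l → S) →ₗ[S] LinearMap.ker π}
    (hπ' : Function.Surjective π') {𝔞 : Ideal S} (hy : FactorsThroughFree y M)
    (hreg : ∀ a, y * a ∈ 𝔞 → a ∈ 𝔞) (h : AnnihilatesTorOne c π' (𝔞 ⊔ Ideal.span {y})) :
    AnnihilatesTorOne c π 𝔞 := by
  intro u hu
  have hyu : y • u ∈ 𝔞 • (⊤ : Submodule S (LinearMap.ker π)) := hy.annihilatesTorOne hπ 𝔞 u hu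
  rw [← LinearMap.range_eq_top.2 hπ', LinearMap.range_eq_map, ← Submodule.map_smul''] at hyu
  obtain ⟨w, hw, hwu⟩ := hyu
  obtain ⟨v, rfl⟩ := hπ' u
  let z : LinearMap.ker π' := ⟨y • v - w, by simp [hwu]⟩
  have hz : (z : Fin l → S) ∈ (𝔞 ⊔ Ideal.span {y}) • (⊤ : Submodule S (Fin l → S)) := by
    rw [Submodule.sup_smul]
    exact sub_mem (Submodule.mem_sup_right (Submodule.smul_mem_smul
      (Ideal.mem_span_singleton_self y) trivial)) (Submodule.mem_sup_left hw)
  have hcz := h z hz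
  rw [Submodule.sup_smul, Submodule.mem_sup] at hcz
  obtain ⟨a, ha, b', hb', hab⟩ := hcz
  rw [Submodule.ideal_span_singleton_smul, Submodule.mem_smul_pointwise_iff_exists] at hb'
  obtain ⟨b, -, rfl⟩ := hb'
  have hab' : (a : Fin l → S) + y • (b : Fin l → S) = c • (y • v - w) :=
    congrArg Subtype.val hab
  have key : c • v - (b : Fin l → S) ∈ 𝔞 • (⊤ : Submodule S (Fin l → S)) := by
    have h1 : y • (c • v - (b : Fin l → S)) ∈ 𝔞 • (⊤ : Submodule S (Fin l → S)) := by
      have : y • (c • v - (b : Fin l → S)) = a + c • w := by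
        rw [smul_sub, smul_comm y c, sub_eq_iff_eq_add, add_right_comm, hab', smul_sub]
        abel
      rw [this]
      exact add_mem (map_mem_ideal_smul_top (LinearMap.ker π').subtype ha)
        (Submodule.smul_mem _ _ hw)
    rw [mem_ideal_smul_top_pi_iff] at h1 ⊢
    exact fun i ↦ hreg _ (h1 i)
  have h2 := map_mem_ideal_smul_top π' key
  rwa [map_sub, map_smul, LinearMap.mem_ker.1 b.2, sub_zero] at h2

/-- If `c` factors through a free module on an `n`-th syzygy of `M`, and if multiplication by
each of `n` elements `ys` which form a regular sequence on `S ⧸ (xs)` factors through a free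
module on `M`, then `c` annihilates `Tor₁(M, S ⧸ (xs))`. -/
theorem SyzygyFactors.annihilatesTorOne [IsNoetherianRing S] {c : S} {n : ℕ}
    (h : SyzygyFactors c n M) {xs ys : List S} (hlen : ys.length = n)
    (hys : ∀ y ∈ ys, FactorsThroughFree y M)
    (hreg : IsWeaklyRegular S (xs ++ ys)) {k : ℕ} {π : (Fin k → S) →ₗ[S] M}
    (hπ : Function.Surjective π) : AnnihilatesTorOne c π (Ideal.ofList xs) := by
  induction h generalizing xs ys k with
  | zero M h => exact h.annihilatesTorOne hπ _
  | succ n M l ρ hρ h ih =>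
    obtain _ | ⟨y, ys⟩ := ys
    · simp at hlen
    suffices H : AnnihilatesTorOne c ρ (Ideal.ofList xs) from H.of_presentation hρ hπ
    obtain ⟨m, σ, hσ⟩ := Module.Finite.exists_fin' S (LinearMap.ker ρ)
    refine AnnihilatesTorOne.of_ker hρ hσ (hys y (by simp)) (fun a ha ↦ ?_) ?_
    · have h1 := ((isWeaklyRegular_append_iff S xs (y :: ys)).1 hreg).2
      have h2 := ((isWeaklyRegular_cons_iff _ _ _).1 h1).1
      rw [isSMulRegular_quotient_iff_mem_of_smul_mem] at h2
      simpa using h2 a (by simpa using ha)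
    · rw [← Ideal.ofList_singleton, ← Ideal.ofList_append]
      exact ih (by simpa using hlen) (fun z hz ↦ (hys z (by simp [hz])).ker hρ) (by simpa) hσ

end

section

variable {S : Type u} [CommRing S] [IsNoetherianRing S]

/-- If the localizations of `M` at the primes not containing `f` are projective, then some power
of `f` factors through a free module on `M`. -/
theorem exists_pow_factorsThroughFree (f : S) (M : Type u) [AddCommGroup M] [Module S M]
    [Module.Finite S M] (h : ∀ (Q : Ideal S) [Q.IsPrime], f ∉ Q →
      Module.Projective (Localization Q.primeCompl) (LocalizedModule Q.primeCompl M)) :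
    ∃ N : ℕ, FactorsThroughFree (f ^ N) M := by
  obtain ⟨k, π, hπ⟩ := Module.Finite.exists_fin' S M
  -- the ideal of all `c` such that `c • id` lifts along `π`
  let J : Ideal S :=
    (LinearMap.range (π.compRight S : (M →ₗ[S] (Fin k → S)) →ₗ[S] (M →ₗ[S] M))).comap
      (LinearMap.toSpanSingleton S (M →ₗ[S] M) LinearMap.id)
  have hJ : ∀ c : S, c ∈ J ↔ ∃ α : M →ₗ[S] (Fin k → S), π ∘ₗ α = c • LinearMap.id :=
    fun c ↦ Iff.rfl
  suffices hf : f ∈ J.radical by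
    obtain ⟨N, hN⟩ := hf
    obtain ⟨α, hα⟩ := (hJ _).1 hN
    exact ⟨N, k, α, π, hα⟩
  rw [Ideal.radical_eq_sInf, Ideal.mem_sInf]
  rintro Q ⟨hJQ, hQ⟩
  by_contra hfQ
  have hproj := h Q hfQ
  have hπQ : Function.Surjective (LocalizedModule.map Q.primeCompl π) :=
    LocalizedModule.map_surjective Q.primeCompl π hπ
  obtain ⟨σ, hσ⟩ := Module.projective_lifting_property _ LinearMap.id hπQ
  have : Module.FinitePresentation S M := Module.finitePresentation_of_finite S M
  obtain ⟨τ, s, hτ⟩ := Module.FinitePresentation.exists_lift_of_isLocalizedModule Q.primeCompl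
    (LocalizedModule.mkLinearMap Q.primeCompl (Fin k → S))
    ((σ.restrictScalars S) ∘ₗ LocalizedModule.mkLinearMap Q.primeCompl M)
  obtain ⟨t, ht⟩ := Module.Finite.exists_smul_of_comp_eq_of_isLocalizedModule
    (S := Q.primeCompl) (f := LocalizedModule.mkLinearMap Q.primeCompl M) (π ∘ₗ τ)
    ((s : S) • LinearMap.id) (by
      ext m
      have h1 := LinearMap.congr_fun hτ m
      have h2 := congrArg (LocalizedModule.map Q.primeCompl π) h1
      have h3 := LinearMap.congr_fun hσ (LocalizedModule.mkLinearMap Q.primeCompl M m)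
      simp only [LinearMap.comp_apply, LocalizedModule.mkLinearMap_apply, LocalizedModule.map_mk,
        LinearMap.smul_apply, LinearMap.restrictScalars_apply, LinearMap.id_apply] at h2 h3 ⊢
      rw [h2, Submonoid.smul_def, LinearMap.map_smul_of_tower, h3]
      simp [LocalizedModule.smul'_mk])
  refine (t * s).2 (hJQ ((hJ _).2 ⟨(t : S) • τ, ?_⟩))
  rw [LinearMap.comp_smul]
  refine (show (t : S) • (π ∘ₗ τ) = _ from ht).trans ?_
  simp [Submonoid.smul_def, smul_smul]

/-- If the localizations of `M` at the primes not containing `f` have projective dimension at most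
`n`, then some power of `f` factors through a free module on an `n`-th syzygy of `M`. -/
theorem exists_pow_syzygyFactors (f : S) (n : ℕ) (M : Type u) [AddCommGroup M] [Module S M]
    [Module.Finite S M] (h : ∀ (Q : Ideal S) [Q.IsPrime], f ∉ Q →
      HasProjectiveDimensionLE ((ModuleCat.of S M).localizedModule Q.primeCompl) n) :
    ∃ N : ℕ, SyzygyFactors (f ^ N) n M := by
  induction n generalizing M with
  | zero =>
    obtain ⟨N, hN⟩ := exists_pow_factorsThroughFree f M fun Q _ hQ ↦ by
      have h0 := h Q hQ
      rw [← projective_iff_hasProjectiveDimensionLE_zero, ← IsProjective.iff_projective] at h0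
      have := ModuleCat.localizedModule_isLocalizedModule (ModuleCat.of S M) Q.primeCompl
      exact Module.Projective.of_equiv (LinearEquiv.extendScalarsOfIsLocalization Q.primeCompl
        (Localization.AtPrime Q) (IsLocalizedModule.linearEquiv Q.primeCompl
        ((ModuleCat.of S M).localizedModuleMkLinearMap Q.primeCompl)
        (LocalizedModule.mkLinearMap Q.primeCompl M)))
    exact ⟨N, .zero M hN⟩
  | succ n ih =>
    obtain ⟨k, π, hπ⟩ := Module.Finite.exists_fin' S M
    obtain ⟨N, hN⟩ := ih (LinearMap.ker π) fun Q _ hQ ↦ by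
      have hex := (LinearMap.shortExact_shortComplexKer hπ).map_of_exact
        (ModuleCat.localizedModuleFunctor.{u} Q.primeCompl)
      refine (hex.hasProjectiveDimensionLT_X₃_iff n ?_).1 (h Q hQ)
      exact (ModuleCat.localizedModuleFunctor.{u} Q.primeCompl).projective_obj_of_projective
        (ModuleCat.projective_of_categoryTheory_projective _)
    exact ⟨N, .succ n M k π hπ hN⟩

end

end

/-! ### Frobenius splittings relative to an element -/

section

open IsLocalRing RingTheory.Sequence Module Pointwise

section FrobeniusSplitting

variable {R : Type u} [CommRing R] {p : ℕ} {ψ : R →+ R} {f : R}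

/-- A sufficiently high iterate `Ψ = ψ ^ e` of a splitting relative to `f` is a splitting relative
to any given power of `f`. -/
theorem exists_iterate_apply_pow_mul_eq_one (hp : p ≠ 0) (hψ : ∀ a b, ψ (a ^ p * b) = a * ψ b)
    (hf : ψ f = 1) (N : ℕ) : ∃ (e : ℕ) (Ψ : R →+ R), (∀ a b, Ψ (a ^ p ^ e * b) = a * Ψ b) ∧
      ∃ g, Ψ (f ^ N * g) = 1 := by
  -- inductively `Ψ (f ^ s) = 1` with `s = 1 + p + ⋯ + p ^ (e - 1)`
  suffices H : ∀ e, ∃ (Ψ : R →+ R), (∀ a b, Ψ (a ^ p ^ e * b) = a * Ψ b) ∧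
      ∃ s, e ≤ s ∧ Ψ (f ^ s) = 1 by
    obtain ⟨Ψ, h1, s, hs, h2⟩ := H N
    exact ⟨N, Ψ, h1, f ^ (s - N), by rwa [← pow_add, Nat.add_sub_cancel' hs]⟩
  intro e
  induction e with
  | zero => exact ⟨.id R, fun a b ↦ by simp, 0, le_rfl, by simp⟩
  | succ e ih =>
    obtain ⟨Ψ, h1, s, hs, h2⟩ := ih
    refine ⟨Ψ.comp ψ, fun a b ↦ ?_, s * p + 1, ?_, ?_⟩
    · rw [AddMonoidHom.comp_apply, pow_succ, pow_mul, hψ, h1, AddMonoidHom.comp_apply]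
    · exact Nat.succ_le_succ (hs.trans (Nat.le_mul_of_pos_right s (Nat.pos_of_ne_zero hp)))
    · rw [pow_succ, pow_mul, AddMonoidHom.comp_apply, hψ, hf, mul_one, h2]

theorem isReduced_of_apply_eq_one (hp : 2 ≤ p) (hψ : ∀ a b, ψ (a ^ p * b) = a * ψ b)
    (hf : ψ f = 1) : IsReduced R := by
  rw [isReduced_iff_pow_one_lt 2 one_lt_two]
  intro x hx
  have h1 : x ^ p = 0 := by rw [← Nat.sub_add_cancel hp, pow_add, hx, mul_zero]
  simpa [h1, hf] using (hψ x f).symm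

/-- If two ideals of a local ring have product zero and their sum contains a power of `f`, then one
of them is zero. Indeed, an iterate of the splitting maps some multiple of this power of `f` to `1`,
and it maps `𝔞` to elements annihilated by `𝔟` and conversely, so one annihilator contains a
unit. -/
theorem eq_bot_or_eq_bot_of_mem_radical_sup [IsLocalRing R] (hp : p ≠ 0)
    (hψ : ∀ a b, ψ (a ^ p * b) = a * ψ b) (hf : ψ f = 1) {𝔞 𝔟 : Ideal R} (hab : 𝔞 * 𝔟 = ⊥)
    (hfab : f ∈ (𝔞 ⊔ 𝔟).radical) : 𝔞 = ⊥ ∨ 𝔟 = ⊥ := by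
  obtain ⟨N, hN⟩ := hfab
  obtain ⟨a, ha, b, hb, hfN⟩ := Submodule.mem_sup.1 hN
  obtain ⟨e, Ψ, hΨ, g, hg⟩ := exists_iterate_apply_pow_mul_eq_one hp hψ hf N
  have key {a c : R} (hac : c * a = 0) : c * Ψ (a * g) = 0 := by
    rw [← hΨ, ← mul_assoc, ← Nat.sub_add_cancel (Nat.one_le_pow e p (by omega)), pow_succ,
      mul_assoc _ c a, hac]
    simp
  have hzero {a b : R} (ha : a ∈ 𝔞) (hb : b ∈ 𝔟) : a * b = 0 := by
    have := Ideal.mul_mem_mul ha hb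
    rwa [hab] at this
  rw [← hfN, add_mul, map_add] at hg
  rcases isUnit_or_isUnit_of_isUnit_add (hg ▸ isUnit_one) with h | h
  · right
    refine (Submodule.eq_bot_iff _).2 fun c hc ↦ ?_
    exact (h.mul_left_eq_zero).1 (key (by rw [mul_comm]; exact hzero ha hc))
  · left
    refine (Submodule.eq_bot_iff _).2 fun c hc ↦ ?_
    exact (h.mul_left_eq_zero).1 (key (hzero hc hb))

/-- A property of minimal primes which is constant near every prime not containing `f` is
constant. -/
theorem forall_minimalPrimes_or_forall_minimalPrimes_not [IsLocalRing R] [IsNoetherianRing R]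
    (hp : 2 ≤ p) (hψ : ∀ a b, ψ (a ^ p * b) = a * ψ b) (hf : ψ f = 1) (pr : Ideal R → Prop)
    (hpr : ∀ Q : Ideal R, Q.IsPrime → f ∉ Q → ∀ P₁ ∈ minimalPrimes R, ∀ P₂ ∈ minimalPrimes R,
      P₁ ≤ Q → P₂ ≤ Q → pr P₁ → pr P₂) :
    (∀ P ∈ minimalPrimes R, pr P) ∨ ∀ P ∈ minimalPrimes R, ¬ pr P := by
  have := isReduced_of_apply_eq_one hp hψ hf
  have hfin := minimalPrimes.finite_of_isNoetherianRing R
  -- a prime containing the intersection of finitely many minimal primes contains one of them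
  have aux (A : Set (Ideal R)) (hA : A ⊆ minimalPrimes R) (Q : Ideal R) [hQ : Q.IsPrime]
      (h : sInf A ≤ Q) : ∃ P ∈ A, P ≤ Q := by
    have hAfin := hfin.subset hA
    rw [← hAfin.coe_toFinset, ← Finset.inf_id_eq_sInf] at h
    obtain ⟨P, hP, hle⟩ := (Ideal.IsPrime.inf_le' hQ).1 h
    exact ⟨P, by simpa using hP, hle⟩
  let A := {P ∈ minimalPrimes R | pr P}
  let B := {P ∈ minimalPrimes R | ¬ pr P}
  have hmul : sInf A * sInf B = ⊥ := by
    refine le_bot_iff.1 ?_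
    have hnil : sInf (minimalPrimes R) = ⊥ := Ideal.sInf_minimalPrimes.trans (nilradical_eq_zero R)
    rw [← hnil]
    refine le_sInf fun P hP ↦ ?_
    by_cases h : pr P
    · exact Ideal.mul_le_left.trans (sInf_le ⟨hP, h⟩)
    · exact Ideal.mul_le_right.trans (sInf_le ⟨hP, h⟩)
  have hrad : f ∈ (sInf A ⊔ sInf B).radical := by
    rw [Ideal.radical_eq_sInf, Ideal.mem_sInf]
    rintro Q ⟨hle, hQ⟩
    by_contra hfQ
    obtain ⟨P₁, hP₁, h1⟩ := aux A (Set.sep_subset _ _) Q (le_sup_left.trans hle)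
    obtain ⟨P₂, hP₂, h2⟩ := aux B (Set.sep_subset _ _) Q (le_sup_right.trans hle)
    exact hP₂.2 (hpr Q hQ hfQ P₁ hP₁.1 P₂ hP₂.1 h1 h2 hP₁.2)
  rcases eq_bot_or_eq_bot_of_mem_radical_sup (by omega) hψ hf hmul hrad with h | h
  · left
    intro P hP
    have := hP.1.1
    obtain ⟨P', hP', hle⟩ := aux A (Set.sep_subset _ _) P (h ▸ bot_le)
    rw [← le_antisymm hle (hP.2 hP'.1.1 hle)]
    exact hP'.2
  · right
    intro P hP
    have := hP.1.1
    obtain ⟨P', hP', hle⟩ := aux B (Set.sep_subset _ _) P (h ▸ bot_le)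
    rw [← le_antisymm hle (hP.2 hP'.1.1 hle)]
    exact hP'.2

/-- If `f ^ N` multiplies the colon ideals `(l ^ q : x ^ q)` into `(l ^ q)` for all powers `q` of
`p`, with `N` independent of `q`, then `x` is a nonzerodivisor modulo `(l)`: for `u x ∈ (l)` apply
an iterate `Ψ` of the splitting with `Ψ (f ^ N g) = 1` to `f ^ N u ^ q g ∈ (l ^ q)`. -/
theorem mem_ofList_of_forall_pow_mul_mem [Fact p.Prime] [CharP R p]
    (hψ : ∀ a b, ψ (a ^ p * b) = a * ψ b) (hf : ψ f = 1) {N : ℕ} {l : List R} {x : R}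
    (h : ∀ (e : ℕ) (u : R), u * x ^ p ^ e ∈ Ideal.ofList (l.map (· ^ p ^ e)) →
      f ^ N * u ∈ Ideal.ofList (l.map (· ^ p ^ e))) {u : R} (hu : u * x ∈ Ideal.ofList l) :
    u ∈ Ideal.ofList l := by
  obtain ⟨e, Ψ, hΨ, g, hg⟩ :=
    exists_iterate_apply_pow_mul_eq_one (Fact.out : p.Prime).ne_zero hψ hf N
  have h1 := Ideal.mem_map_of_mem (iterateFrobenius R p e) hu
  rw [Ideal.map_ofList, List.map_congr_left (fun a _ ↦ iterateFrobenius_def (R := R) p e a),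
    iterateFrobenius_def, mul_pow] at h1
  have h2 := h e (u ^ p ^ e) h1
  have key : ∀ v ∈ Ideal.ofList (l.map (· ^ p ^ e)), ∀ r, Ψ (v * r) ∈ Ideal.ofList l := by
    intro v hv
    induction hv using Submodule.span_induction with
    | mem v hv =>
      obtain ⟨y, hy, rfl⟩ := List.mem_map.1 hv
      intro r
      rw [hΨ]
      exact Ideal.mul_mem_right _ _ (Ideal.subset_span hy)
    | zero => simp
    | add v w _ _ hv hw =>
      intro r
      rw [add_mul, map_add]
      exact add_mem (hv r) (hw r)
    | smul a v _ hv =>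
      intro r
      rw [smul_eq_mul, mul_comm a v, mul_assoc]
      exact hv (a * r)
  have h3 := key _ h2 g
  rwa [mul_comm (f ^ N), mul_assoc, hΨ, hg, mul_one] at h3

end FrobeniusSplitting

end

/-! ### Equidimensionality -/

section

open IsLocalRing RingTheory.Sequence Module Pointwise

theorem ringKrullDim_quotient_le_of_forall_minimalPrimes {S : Type u} [CommRing S] {I : Ideal S}
    {d : WithBot ℕ∞} (h : ∀ P ∈ I.minimalPrimes, ringKrullDim (S ⧸ P) ≤ d) :
    ringKrullDim (S ⧸ I) ≤ d := by
  rw [ringKrullDim_quotient]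
  refine iSup_le fun s ↦ ?_
  have := s.head.1.2
  obtain ⟨P, hP, hle⟩ := Ideal.exists_minimalPrimes_le (I := I) (J := s.head.1.asIdeal) s.head.2
  refine le_trans ?_ (h P hP)
  rw [ringKrullDim_quotient]
  let s' : LTSeries (PrimeSpectrum.zeroLocus (P : Set S)) :=
    { length := s.length
      toFun := fun i ↦ ⟨(s i).1, fun a ha ↦ (LTSeries.head_le s i : s.head ≤ s i) (hle ha)⟩
      step := fun i ↦ s.step i }
  exact Order.LTSeries.length_le_krullDim s'

/-- If the localization of `S ⧸ I` at `Q` is Cohen–Macaulay of dimension `t`, then every minimal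
prime of `I` below `Q` has height `dim S_Q - t`. -/
theorem ringKrullDim_localization_eq_height_add {S : Type u} [CommRing S] [IsRegularRing S]
    {I P Q : Ideal S} [Q.IsPrime] (hP : P ∈ I.minimalPrimes) (hPQ : P ≤ Q) {t : ℕ}
    (hM : HasRegularSequence (Localization Q.primeCompl)
      (LocalizedModule Q.primeCompl (S ⧸ I)) t)
    (ht : supportDim (Localization Q.primeCompl) (LocalizedModule Q.primeCompl (S ⧸ I)) = t) :
    ringKrullDim (Localization Q.primeCompl) = P.height + t := by
  have hPp : P.IsPrime := hP.1.1
  have hreg : IsRegularLocalRing (Localization Q.primeCompl) :=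
    inferInstanceAs (IsRegularLocalRing (Localization.AtPrime Q))
  have hdisj : Disjoint (Q.primeCompl : Set S) (P : Set S) :=
    Set.disjoint_left.2 fun a ha haP ↦ ha (hPQ haP)
  let P' := P.map (algebraMap S (Localization Q.primeCompl))
  have hP' : P'.IsPrime := IsLocalization.isPrime_of_isPrime_disjoint Q.primeCompl _ P hPp hdisj
  have hass : P' ∈ associatedPrimes (Localization Q.primeCompl)
      (LocalizedModule Q.primeCompl (S ⧸ I)) := by
    refine
      Module.associatedPrimes.mem_associatedPrimes_of_comap_mem_associatedPrimes_of_isLocalizedModule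
      Q.primeCompl (LocalizedModule.mkLinearMap Q.primeCompl (S ⧸ I)) P' ?_
    have h1 : P'.comap (algebraMap S (Localization Q.primeCompl)) = P :=
      IsLocalization.under_map_of_isPrime_disjoint Q.primeCompl _ hPp hdisj
    rw [h1]
    apply Module.associatedPrimes.minimalPrimes_annihilator_subset_associatedPrimes S (S ⧸ I)
    rwa [Ideal.annihilator_quotient]
  obtain ⟨rs, hlen, hmem, hrs⟩ := hM
  have h1 := length_le_ringKrullDim_quotient_of_isAssociatedPrime hmem hrs.1 hass
  have h2 := ringKrullDim_quotient_le_supportDim_of_mem_support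
    (M := LocalizedModule Q.primeCompl (S ⧸ I)) (P := ⟨P', hP'⟩) (by
      obtain ⟨-, x, hx⟩ := isAssociatedPrime_iff.1 hass
      rw [Module.support_eq_zeroLocus]
      intro a ha
      change a ∈ P'
      rw [hx, Submodule.mem_colon_singleton, Submodule.mem_bot]
      exact mem_annihilator.1 ha x)
  rw [IsRegularLocalRing.ringKrullDim_eq_height_add P',
    IsLocalization.height_map_of_disjoint Q.primeCompl P hdisj]
  congr 1
  rw [hlen] at h1
  rw [ht] at h2
  exact le_antisymm h2 h1

variable {S : Type u} [CommRing S] [IsRegularLocalRing S] [IsRegularRing S] {I : Ideal S}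
  {f : S} {p : ℕ} {ψ : S ⧸ I →+ S ⧸ I}

/-- A Frobenius splitting relative to `f` makes `S ⧸ I` equidimensional if it is Cohen–Macaulay
away from `f`. -/
theorem exists_forall_minimalPrimes_height_eq (hI : I ≤ maximalIdeal S) (hp : 2 ≤ p)
    (hψ : ∀ a b, ψ (a ^ p * b) = a * ψ b) (hf : ψ (Ideal.Quotient.mk I f) = 1)
    (hCM : ∀ (Q : Ideal S) [Q.IsPrime], I ≤ Q → f ∉ Q →
      IsCohenMacaulayModule (Localization Q.primeCompl) (LocalizedModule Q.primeCompl (S ⧸ I))) :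
    ∃ h d : ℕ, (∀ P ∈ I.minimalPrimes, P.height = h) ∧ ringKrullDim (S ⧸ I) = d ∧
      ringKrullDim S = (h + d : ℕ) := by
  have : Nontrivial (S ⧸ I) := Ideal.Quotient.nontrivial_iff.2
    (fun h ↦ (maximalIdeal.isMaximal S).ne_top (top_le_iff.1 (h ▸ hI)))
  have : IsLocalRing (S ⧸ I) := .of_surjective' (Ideal.Quotient.mk _) Ideal.Quotient.mk_surjective
  obtain ⟨P₀, hP₀, -⟩ := Ideal.exists_minimalPrimes_le (I := I) (J := maximalIdeal S) hI
  have hmin : I.minimalPrimes = Ideal.comap (Ideal.Quotient.mk I) '' minimalPrimes (S ⧸ I) :=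
    Ideal.minimalPrimes_eq_comap
  have hall : ∀ P ∈ I.minimalPrimes, P.height = P₀.height := by
    -- a prime `Q` not containing `f` determines the height of the minimal primes below it
    have hor := forall_minimalPrimes_or_forall_minimalPrimes_not hp hψ hf
      (fun P ↦ (P.comap (Ideal.Quotient.mk I)).height = P₀.height) ?_
    · rcases hor with h | h
      · intro P hP
        rw [hmin] at hP
        obtain ⟨P, hP, rfl⟩ := hP
        exact h P hP
      · rw [hmin] at hP₀
        obtain ⟨P, hP, rfl⟩ := hP₀
        exact absurd rfl (h P hP)
    · intro Q hQ hfQ P₁ hP₁ P₂ hP₂ h1 h2 heq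
      obtain ⟨t, hreg, ht⟩ := hCM (Q.comap (Ideal.Quotient.mk I))
        (by rw [← Ideal.map_le_iff_le_comap, Ideal.map_quotient_self]; simp) hfQ
      have e1 := ringKrullDim_localization_eq_height_add (hmin ▸ ⟨P₁, hP₁, rfl⟩)
        (Ideal.comap_mono h1) hreg ht
      have e2 := ringKrullDim_localization_eq_height_add (hmin ▸ ⟨P₂, hP₂, rfl⟩)
        (Ideal.comap_mono h2) hreg ht
      rw [e1] at e2
      rw [← heq]
      refine le_antisymm ?_ ?_
      · exact WithBot.coe_le_coe.1 (ENat.WithBot.add_le_add_natCast_right_iff.1 e2.ge)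
      · exact WithBot.coe_le_coe.1 (ENat.WithBot.add_le_add_natCast_right_iff.1 e2.le)
  obtain ⟨n, hn⟩ : ∃ n : ℕ, ringKrullDim S = n := exists_ringKrullDim_eq_natCast _
  have hP₀p : P₀.IsPrime := hP₀.1.1
  have : IsLocalRing (S ⧸ P₀) := .of_surjective' (Ideal.Quotient.mk _) Ideal.Quotient.mk_surjective
  obtain ⟨d, hd⟩ : ∃ d : ℕ, ringKrullDim (S ⧸ P₀) = d := exists_ringKrullDim_eq_natCast _
  have hdim := IsRegularLocalRing.ringKrullDim_eq_height_add P₀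
  obtain ⟨h, hh⟩ : ∃ h : ℕ, P₀.height = h := ENat.ne_top_iff_exists.1
    (Ideal.height_ne_top hP₀p.ne_top) |>.imp fun _ h ↦ h.symm
  refine ⟨h, d, fun P hP ↦ (hall P hP).trans hh, le_antisymm ?_ ?_, ?_⟩
  · refine ringKrullDim_quotient_le_of_forall_minimalPrimes fun P hP ↦ ?_
    have hPp : P.IsPrime := hP.1.1
    have h1 := IsRegularLocalRing.ringKrullDim_eq_height_add P
    rw [hall P hP, hdim, hd, hh, add_comm, add_comm _ (ringKrullDim (S ⧸ P))] at h1
    exact ENat.WithBot.add_le_add_natCast_right_iff.1 h1.ge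
  · rw [← hd]
    exact ringKrullDim_le_of_surjective (Ideal.Quotient.factor hP₀.1.2)
      (Ideal.Quotient.factor_surjective hP₀.1.2)
  · rw [hdim, hd, hh, Nat.cast_add]
    rfl

/-- The projective dimension of `S ⧸ I` away from `f` is at most the common height of the minimal
primes of `I`. -/
theorem hasProjectiveDimensionLE_localizedModule {S : Type u} [CommRing S] [IsRegularRing S]
    {I : Ideal S} {h : ℕ}
    (hh : ∀ P ∈ I.minimalPrimes, P.height = h) (Q : Ideal S) [Q.IsPrime] (hCM : I ≤ Q →
      IsCohenMacaulayModule (Localization Q.primeCompl) (LocalizedModule Q.primeCompl (S ⧸ I))) :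
    HasProjectiveDimensionLE ((ModuleCat.of S (S ⧸ I)).localizedModule Q.primeCompl) h := by
  have hreg : IsRegularLocalRing (Localization Q.primeCompl) :=
    inferInstanceAs (IsRegularLocalRing (Localization.AtPrime Q))
  let e : LocalizedModule Q.primeCompl (S ⧸ I) ≃ₗ[Localization Q.primeCompl]
      (ModuleCat.of S (S ⧸ I)).localizedModule Q.primeCompl :=
    have := ModuleCat.localizedModule_isLocalizedModule (ModuleCat.of S (S ⧸ I)) Q.primeCompl
    LinearEquiv.extendScalarsOfIsLocalization Q.primeCompl (Localization Q.primeCompl)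
      (IsLocalizedModule.linearEquiv Q.primeCompl
        (LocalizedModule.mkLinearMap Q.primeCompl (S ⧸ I))
        ((ModuleCat.of S (S ⧸ I)).localizedModuleMkLinearMap Q.primeCompl))
  suffices H : HasProjectiveDimensionLE
      (ModuleCat.of (Localization Q.primeCompl) (LocalizedModule Q.primeCompl (S ⧸ I))) h from
    hasProjectiveDimensionLT_of_iso e.toModuleIso _
  by_cases hIQ : I ≤ Q
  · obtain ⟨t, hM, ht⟩ := hCM hIQ
    obtain ⟨P, hP, hPQ⟩ := Ideal.exists_minimalPrimes_le hIQ
    refine IsRegularLocalRing.hasProjectiveDimensionLE hM ht ?_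
    rw [ringKrullDim_localization_eq_height_add hP hPQ hM ht, hh P hP, Nat.cast_add]
    rfl
  · have : Subsingleton (LocalizedModule Q.primeCompl (S ⧸ I)) := by
      obtain ⟨a, ha, haQ⟩ := Set.not_subset.1 hIQ
      rw [LocalizedModule.subsingleton_iff]
      intro m
      refine ⟨a, haQ, ?_⟩
      obtain ⟨m, rfl⟩ := Ideal.Quotient.mk_surjective m
      rw [← Ideal.Quotient.mk_eq_mk, ← Submodule.Quotient.mk_smul, Submodule.Quotient.mk_eq_zero]
      exact I.mul_mem_right _ ha
    have := (ModuleCat.isZero_of_subsingleton (ModuleCat.of (Localization Q.primeCompl)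
      (LocalizedModule Q.primeCompl (S ⧸ I)))).hasProjectiveDimensionLT_zero
    exact hasProjectiveDimensionLT_of_ge _ 0 _ (Nat.zero_le _)

end

/-! ### Regular sequences on Frobenius split quotients of regular local rings -/

section

open IsLocalRing RingTheory.Sequence Module Pointwise

/-- Existence of systems of parameters. -/
theorem exists_list_maximalIdeal_le_radical {R : Type u} [CommRing R] [IsLocalRing R]
    [IsNoetherianRing R] {d : ℕ} (hd : ringKrullDim R = d) :
    ∃ xs : List R, xs.length = d ∧ (∀ x ∈ xs, x ∈ maximalIdeal R) ∧
      maximalIdeal R ≤ (Ideal.ofList xs).radical := by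
  obtain ⟨s, hs, hcard⟩ := Ideal.exists_finset_card_eq_height_of_isNoetherianRing (maximalIdeal R)
  have hof : Ideal.ofList s.toList = Ideal.span s := by
    simp [Ideal.ofList]
  refine ⟨s.toList, ?_, fun x hx ↦ hs.1.2 (Ideal.subset_span (by simpa using hx)), ?_⟩
  · rw [← maximalIdeal_height_eq_ringKrullDim, ← hcard] at hd
    rw [Finset.length_toList]
    exact_mod_cast hd
  · rw [hof, Ideal.radical_eq_sInf]
    refine le_sInf fun J hJ ↦ hs.2 ⟨hJ.2, hJ.1⟩ (le_maximalIdeal hJ.2.ne_top)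

/-- In a Cohen–Macaulay local ring `S`, a regular sequence in `I` of length `dim S - dim S ⧸ I`
can be extended to a system of parameters. -/
theorem HasRegularSequence.exists_list_maximalIdeal_le_radical {S : Type u} [CommRing S]
    [IsLocalRing S] [IsNoetherianRing S] {h d : ℕ} (hS : HasRegularSequence S S (h + d))
    (hdim : ringKrullDim S = (h + d : ℕ)) {I : Ideal S} (hI : I ≤ maximalIdeal S)
    (hd : ringKrullDim (S ⧸ I) ≤ d) :
    ∃ ys xs : List S, ys.length = h ∧ xs.length = d ∧ (∀ y ∈ ys, y ∈ I) ∧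
      (∀ x ∈ xs, x ∈ maximalIdeal S) ∧ maximalIdeal S ≤ (Ideal.ofList (ys ++ xs)).radical := by
  obtain ⟨ys, hlen, hys, hreg⟩ := hS.exists_isRegular_mem hI hd le_rfl
  have hle : Ideal.ofList ys ≤ maximalIdeal S := Ideal.span_le.2 fun y hy ↦ hI (hys y hy)
  have : Nontrivial (S ⧸ Ideal.ofList ys) := Ideal.Quotient.nontrivial_iff.2
    (fun h ↦ (maximalIdeal.isMaximal S).ne_top (top_le_iff.1 (h ▸ hle)))
  have : IsLocalRing (S ⧸ Ideal.ofList ys) :=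
    .of_surjective' (Ideal.Quotient.mk _) Ideal.Quotient.mk_surjective
  have hT : ringKrullDim (S ⧸ Ideal.ofList ys) = d := by
    have h1 := ringKrullDim_add_length_eq_ringKrullDim_of_isRegular _ hreg
    rw [hdim, hlen, add_comm h d, Nat.cast_add] at h1
    exact le_antisymm (ENat.WithBot.add_le_add_natCast_right_iff.1 h1.le)
      (ENat.WithBot.add_le_add_natCast_right_iff.1 h1.ge)
  obtain ⟨zs, hzlen, hzmem, hzrad⟩ := _root_.exists_list_maximalIdeal_le_radical hT
  have hmk : Function.Surjective (Ideal.Quotient.mk (Ideal.ofList ys)) :=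
    Ideal.Quotient.mk_surjective
  have hloc : IsLocalHom (Ideal.Quotient.mk (Ideal.ofList ys)) := hmk.isLocalHom _
  have hzs : zs = (zs.map (Function.surjInv hmk)).map (Ideal.Quotient.mk (Ideal.ofList ys)) := by
    rw [List.map_map, Function.comp_surjInv, List.map_id]
  refine ⟨ys, zs.map (Function.surjInv hmk), hlen, by simpa using hzlen, hys, fun x hx ↦ ?_,
    fun a ha ↦ ?_⟩
  · obtain ⟨z, hz, rfl⟩ := List.mem_map.1 hx
    have hcomap : (maximalIdeal _).comap (Ideal.Quotient.mk (Ideal.ofList ys)) = maximalIdeal S :=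
      ((local_hom_TFAE (Ideal.Quotient.mk (Ideal.ofList ys))).out 0 4).1 hloc
    rw [← hcomap, Ideal.mem_comap, Function.surjInv_eq hmk]
    exact hzmem z hz
  · obtain ⟨k, hk⟩ := hzrad (map_nonunit (Ideal.Quotient.mk (Ideal.ofList ys)) a ha)
    rw [hzs, ← Ideal.map_ofList, ← map_pow, Ideal.mem_quotient_iff_mem_sup, sup_comm,
      ← Ideal.ofList_append] at hk
    exact ⟨k, hk⟩

theorem radical_ofList_append_le_radical_ofList_append_map_pow {S : Type u} [CommRing S]
    (xs ys : List S) (q : ℕ) : (Ideal.ofList (ys ++ xs)).radical ≤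
      (Ideal.ofList (ys ++ xs.map (· ^ q))).radical := by
  rw [Ideal.radical_le_radical_iff]
  refine Ideal.span_le.2 fun a ha ↦ ?_
  rcases List.mem_append.1 ha with ha | ha
  · exact Ideal.le_radical (Ideal.subset_span (List.mem_append_left _ ha))
  · exact ⟨q, Ideal.subset_span (List.mem_append_right _ (List.mem_map.2 ⟨a, ha, rfl⟩))⟩

/-- If `c` annihilates `((𝔞, x) ∩ I) / (𝔞, x) I = Tor₁(S ⧸ I, S ⧸ (𝔞, x))`, and `x` is regular
modulo `𝔞`, then `c` multiplies the colon ideal `(𝔞 + I : x)` into `𝔞 + I`. -/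
theorem mul_mem_sup_of_mul_mem_sup {S : Type u} [CommRing S] {c x : S} {I 𝔞 : Ideal S}
    (hc : ∀ w ∈ I, w ∈ 𝔞 ⊔ Ideal.span {x} → c * w ∈ (𝔞 ⊔ Ideal.span {x}) * I)
    (hx : ∀ z, x * z ∈ 𝔞 → z ∈ 𝔞) {z : S} (hz : z * x ∈ 𝔞 ⊔ I) : c * z ∈ 𝔞 ⊔ I := by
  obtain ⟨a, ha, w, hw, haw⟩ := Submodule.mem_sup.1 hz
  have h1 := hc w hw (by
    rw [← add_sub_cancel_left a w, haw]
    exact sub_mem (Ideal.mem_sup_right (Ideal.mul_mem_left _ _ (Ideal.mem_span_singleton_self x)))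
      (Ideal.mem_sup_left ha))
  rw [Ideal.sup_mul] at h1
  obtain ⟨a', ha', b, hb, hab⟩ := Submodule.mem_sup.1 h1
  obtain ⟨w', hw', rfl⟩ := Ideal.mem_span_singleton_mul.1 hb
  have h2 : c * z - w' ∈ 𝔞 := by
    refine hx _ ?_
    have : x * (c * z - w') = c * a + a' := by
      linear_combination (-c) * haw - hab
    rw [this]
    exact add_mem (Ideal.mul_mem_left _ _ ha) (Ideal.mul_le_left ha')
  rw [← sub_add_cancel (c * z) w']
  exact add_mem (Ideal.mem_sup_left h2) (Ideal.mem_sup_right hw')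

/-- For the presentation of `S ⧸ I` by `S`, annihilation of `Tor₁(S ⧸ I, S ⧸ 𝔞)` is a statement on
`(I ∩ 𝔞) / I 𝔞`. -/
theorem AnnihilatesTorOne.mul_mem {S : Type u} [CommRing S] {c : S} {I 𝔞 : Ideal S}
    (h : AnnihilatesTorOne c (I.mkQ ∘ₗ LinearMap.proj (0 : Fin 1)) 𝔞) {w : S} (hw : w ∈ I)
    (hw' : w ∈ 𝔞) : c * w ∈ 𝔞 * I := by
  have h1 := h ⟨fun _ ↦ w, (Submodule.Quotient.mk_eq_zero I).2 hw⟩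
    (mem_ideal_smul_top_pi_iff.2 fun _ ↦ hw')
  let φ : LinearMap.ker (I.mkQ ∘ₗ LinearMap.proj (0 : Fin 1)) →ₗ[S] S :=
    LinearMap.proj (R := S) (φ := fun _ : Fin 1 ↦ S) 0 ∘ₗ Submodule.subtype _
  have h2 := Submodule.mem_map_of_mem (f := φ) h1
  rw [Submodule.map_smul''] at h2
  refine (smul_mono_right 𝔞 ?_ : _ ≤ 𝔞 • I) h2
  rintro _ ⟨⟨u, hu⟩, -, rfl⟩
  exact (Submodule.Quotient.mk_eq_zero I).1 hu

variable {S : Type u} [CommRing S] [IsRegularLocalRing S] [IsRegularRing S] {I : Ideal S}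
  {f : S} {p : ℕ} {ψ : S ⧸ I →+ S ⧸ I}

/-- If the quotient `S ⧸ I` of a regular local ring has a Frobenius splitting relative to `f` and is
Cohen–Macaulay away from `f`, then it has a regular sequence of length its dimension. -/
theorem exists_isWeaklyRegular_length_eq_ringKrullDim [Fact p.Prime] (hI : I ≤ maximalIdeal S)
    (hpI : (p : S ⧸ I) = 0)
    (hψ : ∀ a b, ψ (a ^ p * b) = a * ψ b) (hf : ψ (Ideal.Quotient.mk I f) = 1)
    (hCM : ∀ (Q : Ideal S) [Q.IsPrime], I ≤ Q → f ∉ Q →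
      IsCohenMacaulayModule (Localization Q.primeCompl) (LocalizedModule Q.primeCompl (S ⧸ I))) :
    ∃ xs : List S, (∀ x ∈ xs, x ∈ maximalIdeal S) ∧
      ringKrullDim (S ⧸ I) = (xs.length : ℕ) ∧
      IsWeaklyRegular (S ⧸ I) (xs.map (Ideal.Quotient.mk I)) := by
  have hpp : p.Prime := Fact.out
  have : Nontrivial (S ⧸ I) := Ideal.Quotient.nontrivial_iff.2
    (fun h ↦ (maximalIdeal.isMaximal S).ne_top (top_le_iff.1 (h ▸ hI)))
  have : CharP (S ⧸ I) p := (CharP.charP_iff_prime_eq_zero hpp).2 hpI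
  obtain ⟨h, d, hh, hd, hn⟩ := exists_forall_minimalPrimes_height_eq hI hpp.two_le hψ hf hCM
  obtain ⟨N, hN⟩ := exists_pow_syzygyFactors f h (S ⧸ I) fun Q _ hQ ↦
    hasProjectiveDimensionLE_localizedModule hh Q fun hIQ ↦ hCM Q hIQ hQ
  have hS := IsRegularLocalRing.hasRegularSequence hn
  obtain ⟨ys, xs, hylen, hxlen, hys, hxs, hrad⟩ :=
    hS.exists_list_maximalIdeal_le_radical hn hI hd.le
  -- elements of `I` act as zero on `S ⧸ I`
  have hy0 : ∀ y ∈ ys, FactorsThroughFree y (S ⧸ I) := by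
    intro y hy
    refine ⟨0, 0, 0, LinearMap.ext fun m ↦ ?_⟩
    obtain ⟨m, rfl⟩ := Ideal.Quotient.mk_surjective m
    have : y • Ideal.Quotient.mk I m = 0 := by
      rw [← Ideal.Quotient.mk_eq_mk, ← Submodule.Quotient.mk_smul, Submodule.Quotient.mk_eq_zero]
      exact I.mul_mem_right _ (hys y hy)
    simpa using this.symm
  have hpow (q : ℕ) (hq : q ≠ 0) : IsWeaklyRegular S (ys ++ xs.map (· ^ q)) := by
    have hlen : (ys ++ xs.map (· ^ q)).length = h + d := by simp [hylen, hxlen]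
    refine (HasRegularSequence.isRegular_of_maximalIdeal_le_radical (hlen ▸ hS) ?_ ?_).1
    · intro a ha
      rcases List.mem_append.1 ha with ha | ha
      · exact hI (hys a ha)
      · obtain ⟨x, hx, rfl⟩ := List.mem_map.1 ha
        exact Ideal.pow_mem_of_mem _ (hxs x hx) q (Nat.pos_of_ne_zero hq)
    · exact hrad.trans (radical_ofList_append_le_radical_ofList_append_map_pow xs ys q)
  have hpow' (q : ℕ) (hq : q ≠ 0) (i : ℕ) : IsWeaklyRegular S ((xs.map (· ^ q)).take i ++ ys) := by
    have h1 := hpow q hq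
    rw [← List.take_append_drop i (xs.map (· ^ q)), ← List.append_assoc,
      isWeaklyRegular_append_iff] at h1
    refine IsLocalRing.isWeaklyRegular_of_perm_of_subset_maximalIdeal h1.1 List.perm_append_comm ?_
    intro a ha
    rcases List.mem_append.1 ha with ha | ha
    · exact hI (hys a ha)
    · obtain ⟨x, hx, rfl⟩ := List.mem_map.1 (List.mem_of_mem_take ha)
      exact Ideal.pow_mem_of_mem _ (hxs x hx) q (Nat.pos_of_ne_zero hq)
  -- the bound `N` in `f ^ N` does not depend on the exponent `q`
  have hcolon (q : ℕ) (hq : q ≠ 0) (i : ℕ) (hi : i < xs.length) (z : S)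
      (hz : z * xs[i] ^ q ∈ Ideal.ofList ((xs.map (· ^ q)).take i) ⊔ I) :
      f ^ N * z ∈ Ideal.ofList ((xs.map (· ^ q)).take i) ⊔ I := by
    have htake : (xs.map (· ^ q)).take (i + 1) = (xs.map (· ^ q)).take i ++ [xs[i] ^ q] := by
      rw [List.take_succ_eq_append_getElem (by simpa using hi)]
      simp
    have hof : Ideal.ofList ((xs.map (· ^ q)).take i) ⊔ Ideal.span {xs[i] ^ q} =
        Ideal.ofList ((xs.map (· ^ q)).take (i + 1)) := by
      rw [htake, Ideal.ofList_append, Ideal.ofList_singleton]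
    refine mul_mem_sup_of_mul_mem_sup (fun w hw hw' ↦ ?_) (fun z hz ↦ ?_) hz
    · rw [hof] at hw' ⊢
      refine (hN.annihilatesTorOne hylen hy0 (hpow' q hq (i + 1)) ?_).mul_mem hw hw'
      exact I.mkQ_surjective.comp (LinearMap.proj_surjective 0)
    · have h1 := hpow' q hq (i + 1)
      rw [htake, List.append_assoc, isWeaklyRegular_append_iff, List.singleton_append,
        isWeaklyRegular_cons_iff, isSMulRegular_quotient_iff_mem_of_smul_mem] at h1
      simpa using h1.2.1 z (by simpa using hz)
  refine ⟨xs, hxs, by rw [hd, hxlen], ?_⟩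
  rw [isWeaklyRegular_iff]
  intro i hi
  rw [isSMulRegular_quotient_iff_mem_of_smul_mem]
  intro u hu
  rw [smul_eq_mul, Ideal.mul_top] at hu ⊢
  rw [smul_eq_mul, mul_comm] at hu
  refine mem_ofList_of_forall_pow_mul_mem hψ hf (N := N) (fun e v hv ↦ ?_) hu
  obtain ⟨v, rfl⟩ := Ideal.Quotient.mk_surjective v
  have hmap : Ideal.ofList (((xs.map (Ideal.Quotient.mk I)).take i).map (· ^ p ^ e)) =
      (Ideal.ofList ((xs.map (· ^ p ^ e)).take i)).map (Ideal.Quotient.mk I) := by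
    rw [Ideal.map_ofList]
    simp [List.map_take, Function.comp_def]
  rw [hmap] at hv ⊢
  rw [List.getElem_map, ← map_pow, ← map_mul, Ideal.mem_quotient_iff_mem_sup] at hv
  rw [← map_pow, ← map_mul, Ideal.mem_quotient_iff_mem_sup]
  exact hcolon (p ^ e) (pow_ne_zero e hpp.ne_zero) i (by simpa using hi) v hv

end

/-! ### Transport of the Cohen–Macaulay property and localization of splittings -/

section

open IsLocalRing RingTheory.Sequence Module Pointwise

/-- The supremum in the definition of the depth is attained by some regular sequence. -/
theorem isCohenMacaulayLocalRing_iff {R : Type u} [CommRing R] [IsLocalRing R]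
    [IsNoetherianRing R] : IsCohenMacaulayLocalRing R ↔ ∃ rs : List R,
      (∀ r ∈ rs, r ∈ maximalIdeal R) ∧ IsRegular R rs ∧ ringKrullDim R = (rs.length : ℕ) := by
  constructor
  · intro h
    obtain ⟨n, hn⟩ := exists_ringKrullDim_eq_natCast R
    have h1 := h.depth_eq
    rw [hn] at h1
    have h2 : localRingDepth R = n := WithBot.coe_inj.1 h1
    have : Nonempty {rs : List R // (∀ r ∈ rs, r ∈ maximalIdeal R) ∧ IsRegular R rs} :=
      ⟨⟨[], by simp, .nil R R⟩⟩
    obtain ⟨rs, hrs⟩ := ENat.exists_eq_iSup_of_lt_top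
      (show localRingDepth R < ⊤ from h2 ▸ ENat.natCast_lt_top n)
    refine ⟨rs.1, rs.2.1, rs.2.2, ?_⟩
    rw [hn, ← h1]
    exact congrArg ((↑) : ℕ∞ → WithBot ℕ∞) hrs.symm
  · rintro ⟨rs, hmem, hreg, hdim⟩
    refine ⟨inferInstance, ?_⟩
    rw [hdim]
    refine congrArg ((↑) : ℕ∞ → WithBot ℕ∞) (le_antisymm (iSup_le fun ws ↦ ?_) ?_)
    · have h1 := ringKrullDim_add_length_eq_ringKrullDim_of_isRegular _ ws.2.2
      have := ws.2.2.quot_ofList_smul_nontrivial ⊤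
      rw [smul_eq_mul, Ideal.mul_top] at this
      rw [hdim] at h1
      have h2 : ((ws.1.length : ℕ) : WithBot ℕ∞) ≤ (rs.length : ℕ) := by
        rw [← h1]
        exact le_add_of_nonneg_left ringKrullDim_nonneg_of_nontrivial
      exact_mod_cast h2
    · exact le_iSup (fun ws : {rs : List R // (∀ r ∈ rs, r ∈ maximalIdeal R) ∧ IsRegular R rs} ↦
        (ws.1.length : ℕ∞)) ⟨rs, hmem, hreg⟩

theorem IsCohenMacaulayLocalRing.of_ringEquiv {R R' : Type u} [CommRing R] [IsLocalRing R]
    [CommRing R'] [IsLocalRing R'] (e : R ≃+* R') (h : IsCohenMacaulayLocalRing R) :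
    IsCohenMacaulayLocalRing R' := by
  have := h.isNoetherianRing
  have := isNoetherianRing_of_ringEquiv R e
  obtain ⟨rs, hmem, hreg, hdim⟩ := isCohenMacaulayLocalRing_iff.1 h
  refine isCohenMacaulayLocalRing_iff.2 ⟨rs.map e, fun r hr ↦ ?_, ?_, ?_⟩
  · obtain ⟨a, ha, rfl⟩ := List.mem_map.1 hr
    exact map_nonunit (e : R →+* R') a (hmem a ha)
  · refine (AddEquiv.isRegular_congr (e := e.toAddEquiv) ?_).1 hreg
    exact List.forall₂_map_right_iff.2 (List.forall₂_same.2 fun r _ x ↦ map_mul e r x)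
  · rw [← ringKrullDim_eq_of_ringEquiv e, hdim, List.length_map]

theorem IsCohenMacaulayModule.of_linearEquiv {S : Type u} [CommRing S] [IsLocalRing S]
    {M M' : Type u} [AddCommGroup M] [Module S M] [AddCommGroup M'] [Module S M'] (e : M ≃ₗ[S] M')
    (h : IsCohenMacaulayModule S M) : IsCohenMacaulayModule S M' := by
  obtain ⟨t, ⟨rs, hlen, hmem, hreg⟩, ht⟩ := h
  exact ⟨t, ⟨rs, hlen, hmem, (e.isRegular_congr rs).1 hreg⟩, (supportDim_eq_of_equiv e) ▸ ht⟩

theorem IsCohenMacaulayLocalRing.isCohenMacaulayModule {S R : Type u} [CommRing S] [IsLocalRing S]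
    [CommRing R] [IsLocalRing R] [Algebra S R] (hsurj : Function.Surjective (algebraMap S R))
    (h : IsCohenMacaulayLocalRing R) : IsCohenMacaulayModule S R := by
  have := h.isNoetherianRing
  obtain ⟨rs, hmem, hreg, hdim⟩ := isCohenMacaulayLocalRing_iff.1 h
  refine ⟨rs.length, ⟨rs.map (Function.surjInv hsurj), by simp, fun r hr ↦ ?_, ?_⟩, ?_⟩
  · obtain ⟨z, hz, rfl⟩ := List.mem_map.1 hr
    have hloc : IsLocalHom (algebraMap S R) := hsurj.isLocalHom _
    have hcomap : (maximalIdeal R).comap (algebraMap S R) = maximalIdeal S :=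
      ((local_hom_TFAE (algebraMap S R)).out 0 4).1 hloc
    rw [← hcomap, Ideal.mem_comap, Function.surjInv_eq hsurj]
    exact hmem z hz
  · refine (AddEquiv.isRegular_congr (e := AddEquiv.refl R) ?_).1 hreg
    refine List.forall₂_map_right_iff.2 (List.forall₂_same.2 fun r _ x ↦ ?_)
    change r * x = Function.surjInv hsurj r • x
    rw [Algebra.smul_def, Function.surjInv_eq hsurj]
  · let e : (S ⧸ RingHom.ker (algebraMap S R)) ≃+* R := RingHom.quotientKerEquivOfSurjective hsurj
    let e' : (S ⧸ RingHom.ker (algebraMap S R)) ≃ₗ[S] R :=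
      (Ideal.quotientKerAlgEquivOfSurjective (f := Algebra.ofId S R) hsurj).toLinearEquiv
    rw [← supportDim_eq_of_equiv e', supportDim_quotient_eq_ringKrullDim,
      ringKrullDim_eq_of_ringEquiv e, hdim]

/-- If `R` is a quotient of `S` and `R_𝔮` is a Cohen–Macaulay ring, then it is a Cohen–Macaulay
module over the localization of `S` at the preimage of `𝔮`. -/
theorem IsCohenMacaulayLocalRing.isCohenMacaulayModule_localizedModule {S R : Type u} [CommRing S]
    [CommRing R] [Algebra S R] (hsurj : Function.Surjective (algebraMap S R)) (Q : Ideal S)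
    [Q.IsPrime] (q : Ideal R) [q.IsPrime] (hq : Q = q.comap (algebraMap S R))
    (h : IsCohenMacaulayLocalRing (Localization.AtPrime q)) :
    IsCohenMacaulayModule (Localization Q.primeCompl) (LocalizedModule Q.primeCompl R) := by
  subst hq
  let φ := Localization.localRingHom (q.comap (algebraMap S R)) q (algebraMap S R) rfl
  let _ : Algebra (Localization.AtPrime (q.comap (algebraMap S R))) (Localization.AtPrime q) :=
    φ.toAlgebra
  have htower : IsScalarTower S (Localization.AtPrime (q.comap (algebraMap S R)))
      (Localization.AtPrime q) := .of_algebraMap_eq fun a ↦ by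
    rw [IsScalarTower.algebraMap_apply S R (Localization.AtPrime q)]
    exact (Localization.localRingHom_to_map _ _ _ rfl a).symm
  have hsub : Algebra.algebraMapSubmonoid R (q.comap (algebraMap S R)).primeCompl =
      q.primeCompl := by
    ext r
    constructor
    · rintro ⟨a, ha, rfl⟩
      exact ha
    · intro hr
      obtain ⟨a, rfl⟩ := hsurj r
      exact ⟨a, hr, rfl⟩
  have hloc : IsLocalization (Algebra.algebraMapSubmonoid R (q.comap (algebraMap S R)).primeCompl)
      (Localization.AtPrime q) := by rw [hsub]; infer_instance
  have hlm := (isLocalizedModule_iff_isLocalization (S := (q.comap (algebraMap S R)).primeCompl)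
    (A := R) (Aₛ := Localization.AtPrime q)).2 hloc
  have hCM := IsCohenMacaulayLocalRing.isCohenMacaulayModule
    (S := Localization.AtPrime (q.comap (algebraMap S R)))
    (RingHom.surjective_localRingHom_of_surjective (algebraMap S R) hsurj q) h
  refine hCM.of_linearEquiv ?_
  exact LinearEquiv.extendScalarsOfIsLocalization (q.comap (algebraMap S R)).primeCompl
    (Localization.AtPrime (q.comap (algebraMap S R)))
    (IsLocalizedModule.linearEquiv (q.comap (algebraMap S R)).primeCompl
      (IsScalarTower.toAlgHom S R (Localization.AtPrime q)).toLinearMap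
      (LocalizedModule.mkLinearMap (q.comap (algebraMap S R)).primeCompl R))

/-- The localization of a Frobenius splitting relative to `f`. -/
theorem exists_localization_apply_pow_mul {B : Type u} [CommRing B] {p : ℕ} (hp : p ≠ 0)
    {ψ : B →+ B} (hψ : ∀ a b, ψ (a ^ p * b) = a * ψ b) {f : B} (hf : ψ f = 1) (M : Submonoid B) :
    ∃ ψ' : Localization M →+ Localization M, (∀ a b, ψ' (a ^ p * b) = a * ψ' b) ∧
      ψ' (algebraMap B _ f) = 1 := by
  obtain ⟨p, rfl⟩ : ∃ k, p = k + 1 := ⟨p - 1, by omega⟩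
  -- `ψ (b / s) = ψ (b s ^ (p - 1) / s ^ p) = ψ (b s ^ (p - 1)) / s`
  let φ : Localization M → Localization M := fun x ↦ Localization.liftOn x
    (fun b s ↦ Localization.mk (ψ (b * s ^ p)) s) (by
      intro b b' s s' h
      obtain ⟨c, hc⟩ := Localization.r_iff_exists.1 h
      refine Localization.mk_eq_mk_iff.2 (Localization.r_iff_exists.2 ⟨c, ?_⟩)
      rw [← mul_assoc, ← mul_assoc, ← Submonoid.coe_mul, ← Submonoid.coe_mul, ← hψ, ← hψ]
      congr 1
      simp only [Submonoid.coe_mul]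
      linear_combination (c * s * s' : B) ^ p * hc)
  have hφ (b : B) (s : M) : φ (Localization.mk b s) = Localization.mk (ψ (b * s ^ p)) s := rfl
  refine ⟨AddMonoidHom.mk' φ fun x y ↦ ?_, fun x y ↦ ?_, ?_⟩
  · induction x, y using Localization.induction_on₂ with | _ x y
    obtain ⟨b, s⟩ := x
    obtain ⟨c, t⟩ := y
    simp only [Localization.add_mk, hφ]
    congr 1
    rw [← hψ, ← hψ, ← map_add]
    congr 1
    simp only [Submonoid.coe_mul]
    ring
  · induction x, y using Localization.induction_on₂ with | _ x y
    obtain ⟨b, s⟩ := x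
    obtain ⟨c, t⟩ := y
    simp only [AddMonoidHom.mk'_apply, Localization.mk_pow, Localization.mk_mul, hφ]
    rw [← hψ, Localization.mk_eq_mk_iff, Localization.r_iff_exists]
    refine ⟨1, ?_⟩
    rw [OneMemClass.coe_one, one_mul, one_mul, ← hψ, ← hψ]
    congr 1
    simp only [Submonoid.coe_mul, SubmonoidClass.coe_pow]
    ring
  · change φ (Localization.mk f 1) = 1
    simp [hφ, hf, Localization.mk_one]

end

/-! ### Cohen–Macaulayness of Frobenius split rings of finite type -/

section

open IsLocalRing RingTheory.Sequence Module Pointwise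

theorem isRegularRing_localization {R : Type u} [CommRing R] [IsRegularRing R] (M : Submonoid R) :
    IsRegularRing (Localization M) := by
  have := IsLocalization.isNoetherianRing M (Localization M) inferInstance
  rw [isRegularRing_iff]
  intro q _
  let e := IsLocalization.algEquiv (q.under R).primeCompl (Localization.AtPrime (q.under R))
    (Localization.AtPrime q)
  exact IsRegularLocalRing.of_ringEquiv e.toRingEquiv

theorem isCohenMacaulayLocalRing_quotient {S : Type u} [CommRing S] [IsRegularLocalRing S]
    [IsRegularRing S] {I : Ideal S} [IsLocalRing (S ⧸ I)] {f : S} {p : ℕ} {ψ : S ⧸ I →+ S ⧸ I}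
    [Fact p.Prime] (hpI : (p : S ⧸ I) = 0) (hψ : ∀ a b, ψ (a ^ p * b) = a * ψ b)
    (hf : ψ (Ideal.Quotient.mk I f) = 1)
    (hCM : ∀ (Q : Ideal S) [Q.IsPrime], I ≤ Q → f ∉ Q →
      IsCohenMacaulayModule (Localization Q.primeCompl) (LocalizedModule Q.primeCompl (S ⧸ I))) :
    IsCohenMacaulayLocalRing (S ⧸ I) := by
  have hI : I ≤ maximalIdeal S :=
    le_maximalIdeal (Ideal.Quotient.nontrivial_iff.1 inferInstance)
  obtain ⟨xs, hxs, hdim, hreg⟩ :=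
    exists_isWeaklyRegular_length_eq_ringKrullDim hI hpI hψ hf hCM
  have hloc : IsLocalHom (Ideal.Quotient.mk I) := Ideal.Quotient.mk_surjective.isLocalHom _
  have hmem : ∀ r ∈ xs.map (Ideal.Quotient.mk I), r ∈ maximalIdeal (S ⧸ I) := by
    intro r hr
    obtain ⟨x, hx, rfl⟩ := List.mem_map.1 hr
    exact map_nonunit (Ideal.Quotient.mk I) x (hxs x hx)
  exact isCohenMacaulayLocalRing_iff.2 ⟨_, hmem,
    (IsLocalRing.isRegular_iff_isWeaklyRegular_of_subset_maximalIdeal hmem).2 hreg,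
    by rw [hdim, List.length_map]⟩

/-- A quotient of a regular local ring with a Frobenius splitting relative to `f` is Cohen–Macaulay
if it is so at the primes not containing `f`. -/
theorem isCohenMacaulayLocalRing_of_surjective {S R : Type u} [CommRing S] [IsRegularLocalRing S]
    [IsRegularRing S] [CommRing R] [IsLocalRing R] {g : S →+* R} (hg : Function.Surjective g)
    {p : ℕ} [Fact p.Prime] (hpR : (p : R) = 0) {ψ : R →+ R} (hψ : ∀ a b, ψ (a ^ p * b) = a * ψ b)
    {f : R} (hf : ψ f = 1) (hCM : ∀ (Q : Ideal R) [Q.IsPrime], f ∉ Q →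
      IsCohenMacaulayLocalRing (Localization.AtPrime Q)) :
    IsCohenMacaulayLocalRing R := by
  let I := RingHom.ker g
  let e : S ⧸ I ≃+* R := RingHom.quotientKerEquivOfSurjective hg
  have he (a : S) : e (Ideal.Quotient.mk I a) = g a := rfl
  obtain ⟨f', hgf⟩ := hg f
  have hlocal : IsLocalRing (S ⧸ I) := e.symm.isLocalRing
  refine IsCohenMacaulayLocalRing.of_ringEquiv e (isCohenMacaulayLocalRing_quotient (f := f')
    (p := p) (ψ := (e.symm : R →+ S ⧸ I).comp (ψ.comp (e : S ⧸ I →+ R))) ?_ ?_ ?_ ?_)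
  · refine e.injective ?_
    rw [map_natCast, map_zero, hpR]
  · intro a b
    refine e.injective ?_
    simp [hψ]
  · refine e.injective ?_
    change e (e.symm (ψ (e (Ideal.Quotient.mk I f')))) = _
    rw [he, hgf, e.apply_symm_apply, map_one, hf]
  · intro Q _ hIQ hfQ
    have hker : RingHom.ker (Ideal.Quotient.mk I) ≤ Q := by rwa [Ideal.mk_ker]
    let q : Ideal (S ⧸ I) := Q.map (Ideal.Quotient.mk I)
    have hq : q.IsPrime := Ideal.map_isPrime_of_surjective Ideal.Quotient.mk_surjective hker
    have hQq : Q = q.comap (algebraMap S (S ⧸ I)) := (Ideal.comap_map_mk hIQ).symm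
    refine IsCohenMacaulayLocalRing.isCohenMacaulayModule_localizedModule
      Ideal.Quotient.mk_surjective Q q hQq ?_
    let q' : Ideal R := q.comap e.symm
    have hfq : f ∉ q' := by
      intro h
      refine hfQ ?_
      rw [hQq]
      change e.symm f ∈ q at h
      rw [← hgf, ← he, e.symm_apply_apply] at h
      exact h
    exact .of_ringEquiv (IsLocalization.ringEquivOfRingEquiv (Localization.AtPrime q')
      (Localization.AtPrime q) e.symm (e.symm.map_primeCompl_comap_eq q)) (hCM q' hfq)

/-- A ring of finite type over a regular ring, with a Frobenius splitting relative to `f`, is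
Cohen–Macaulay at a prime `m` if it is so at the primes below `m` not containing `f`. -/
theorem isCohenMacaulayLocalRing_localization (A : Type u) {B : Type u} [CommRing A]
    [IsRegularRing A] [CommRing B] [Algebra A B] [Algebra.FiniteType A B] {p : ℕ} [Fact p.Prime]
    (hpB : (p : B) = 0) {ψ : B →+ B} (hψ : ∀ a b, ψ (a ^ p * b) = a * ψ b) {f : B} (hf : ψ f = 1)
    (m : Ideal B) [m.IsPrime] (hCM : ∀ (Q : Ideal B) [Q.IsPrime], Q ≤ m → f ∉ Q →
      IsCohenMacaulayLocalRing (Localization.AtPrime Q)) :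
    IsCohenMacaulayLocalRing (Localization.AtPrime m) := by
  obtain ⟨n, φ, hφ⟩ := Algebra.FiniteType.iff_quotient_mvPolynomial''.1
    (inferInstance : Algebra.FiniteType A B)
  let 𝔐 := m.comap (φ : MvPolynomial (Fin n) A →+* B)
  have hregS : IsRegularRing (Localization.AtPrime 𝔐) := isRegularRing_localization 𝔐.primeCompl
  obtain ⟨ψ', hψ', hf'⟩ := exists_localization_apply_pow_mul (Fact.out : p.Prime).ne_zero hψ hf
    m.primeCompl
  refine isCohenMacaulayLocalRing_of_surjective (S := Localization.AtPrime 𝔐)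
    (g := Localization.localRingHom 𝔐 m (φ : MvPolynomial (Fin n) A →+* B) rfl)
    (RingHom.surjective_localRingHom_of_surjective _ hφ m) (p := p) ?_ hψ' hf' ?_
  · rw [← map_natCast (algebraMap B (Localization.AtPrime m)), hpB, map_zero]
  · intro q _ hfq
    have hle : q.under B ≤ m :=
      (Ideal.comap_mono (le_maximalIdeal (Ideal.IsPrime.ne_top inferInstance))).trans
        (IsLocalization.AtPrime.under_maximalIdeal (Localization.AtPrime m) m).le
    exact .of_ringEquiv (IsLocalization.algEquiv (q.under B).primeCompl
      (Localization.AtPrime (q.under B)) (Localization.AtPrime q)).toRingEquiv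
      (hCM (q.under B) hle hfq)

end

/-! ### Effective Cartier divisors and splittings on affine opens -/

section

open IsLocalRing RingTheory.Sequence Module Pointwise

variable {X : Scheme.{u}} {p : ℕ} [Fact p.Prime] [IsSchemeInChar X p]
  {D : EffectiveCartierDivisor X}

/-- The sections over `U` of a retraction of `𝒪_X ⟶ F_* 𝒪_X(D)`. -/
theorem IsFrobeniusSplitRelativeTo.exists_retraction (hD : IsFrobeniusSplitRelativeTo X p D)
    (U : X.Opens) :
    ∃ θ : D.sheaf.val.obj (op U) →+ Γ(X, U),
      (∀ (a : Γ(X, U)) s hs, θ ⟨D.compl.ι.app U (a ^ p) * s,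
        EffectiveCartierDivisor.IsSectionOfSheaf.smul hs (a ^ p)⟩ = a * θ ⟨s, hs⟩) ∧
      θ ⟨D.compl.ι.app U 1, D.isSectionOfSheaf_app U 1⟩ = 1 := by
  obtain ⟨⟨r, hr⟩⟩ := hD.exists_splitMono
  let θ := (r.val.app (op U)).hom
  refine ⟨⟨⟨fun s ↦ θ s, θ.map_zero⟩, θ.map_add⟩, fun a s hs ↦ ?_, ?_⟩
  · exact θ.map_smul a ⟨s, hs⟩
  · have h1 := congr((($hr).val.app (op U)).hom (1 : Γ(X, U)))
    refine Eq.trans ?_ h1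
    refine congrArg θ (Subtype.ext ?_)
    change D.compl.ι.app U 1 = D.compl.ι.app U ((1 : Γ(X, U)) ^ p)
    rw [one_pow]

theorem EffectiveCartierDivisor.mem_compl_iff {U : X.affineOpens} {f : Γ(X, U)}
    (hf : D.idealSheaf.ideal U = Ideal.span {f}) {x : X} (hx : x ∈ U.1) :
    x ∈ D.compl ↔ x ∈ X.basicOpen f := by
  change ¬ x ∈ D.idealSheaf.support ↔ _
  rw [Scheme.IdealSheafData.mem_support_iff_of_mem hx, hf, Scheme.zeroLocus_span]
  simp [Scheme.mem_zeroLocus_iff]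

/-- A local equation of `D` is invertible on the complement of `D`. -/
theorem EffectiveCartierDivisor.isUnit_ι_app {U : X.affineOpens} {f : Γ(X, U)}
    (hf : D.idealSheaf.ideal U = Ideal.span {f}) : IsUnit (D.compl.ι.app U f) := by
  have h1 : D.compl.ι ⁻¹ᵁ U.1 = D.compl.toScheme.basicOpen (D.compl.ι.app U f) := by
    rw [← Scheme.preimage_basicOpen]
    ext y
    exact ⟨fun hy ↦ (mem_compl_iff hf hy).1 y.2, fun hy ↦ X.basicOpen_le f hy⟩
  refine D.compl.toScheme.toRingedSpace.isUnit_of_isUnit_germ _ _ fun y hy ↦ ?_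
  exact (Scheme.mem_basicOpen _ _ y hy).1 (h1 ▸ hy)

/-- A quotient `b / f` by a local equation `f` of `D` is a section of `𝒪_X(D)`. -/
theorem EffectiveCartierDivisor.isSectionOfSheaf_of_mul {U : X.affineOpens} {f b : Γ(X, U)}
    (hf : D.idealSheaf.ideal U = Ideal.span {f}) {s : Γ(D.compl, D.compl.ι ⁻¹ᵁ U)}
    (hs : D.compl.ι.app U f * s = D.compl.ι.app U b) : D.IsSectionOfSheaf U s := by
  intro W hWU g hg x hx
  rw [← D.idealSheaf.map_ideal hWU, hf, Ideal.map_span, Set.image_singleton,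
    Ideal.mem_span_singleton'] at hg
  obtain ⟨c, rfl⟩ := hg
  refine ⟨W.1, le_rfl, hx, c * X.presheaf.map (homOfLE hWU).op b, ?_⟩
  have hid (a : Γ(X, W)) : X.presheaf.map (homOfLE (le_refl W.1)).op a = a :=
    congr($(X.presheaf.map_id _) a)
  refine Eq.trans ?_ (congrArg (fun t ↦ D.compl.ι.app W t * _) (hid _).symm)
  change D.compl.ι.app W (c * X.presheaf.map (homOfLE hWU).op b) =
    D.compl.ι.app W (c * X.presheaf.map (homOfLE hWU).op f) * _
  rw [map_mul, map_mul, D.ι_app_map hWU, D.ι_app_map hWU, ← hs, map_mul, mul_assoc]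

/-- A splitting of `𝒪_X ⟶ F_* 𝒪_X(D)` gives, over an affine open where `D` is defined by `f`, a
map `b ↦ r (b / f)` which is a Frobenius splitting relative to `f`. -/
theorem IsFrobeniusSplitRelativeTo.exists_apply_pow_mul (hD : IsFrobeniusSplitRelativeTo X p D)
    {U : X.affineOpens} {f : Γ(X, U)} (hf : D.idealSheaf.ideal U = Ideal.span {f}) :
    ∃ ψ : Γ(X, U) →+ Γ(X, U), (∀ a b, ψ (a ^ p * b) = a * ψ b) ∧ ψ f = 1 := by
  obtain ⟨θ, hθ, hθ1⟩ := hD.exists_retraction U.1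
  obtain ⟨v, hv⟩ := (D.isUnit_ι_app hf).exists_right_inv
  have hsec (b : Γ(X, U)) : D.IsSectionOfSheaf U (D.compl.ι.app U b * v) :=
    D.isSectionOfSheaf_of_mul hf (by rw [mul_left_comm, hv, mul_one])
  refine ⟨AddMonoidHom.mk' (fun b ↦ θ ⟨_, hsec b⟩) fun a b ↦ ?_, fun a b ↦ ?_, ?_⟩
  · refine Eq.trans (congrArg θ (Subtype.ext ?_)) (θ.map_add _ _)
    change D.compl.ι.app U (a + b) * v = D.compl.ι.app U a * v + D.compl.ι.app U b * v
    rw [map_add, add_mul]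
  · refine Eq.trans (congrArg θ (Subtype.ext ?_)) (hθ a _ (hsec b))
    change D.compl.ι.app U (a ^ p * b) * v = D.compl.ι.app U (a ^ p) * (D.compl.ι.app U b * v)
    rw [map_mul, mul_assoc]
  · refine Eq.trans (congrArg θ (Subtype.ext ?_)) hθ1
    change D.compl.ι.app U f * v = D.compl.ι.app U 1
    rw [hv, map_one]

theorem AlgebraicGeometry.IsAffineOpen.isCohenMacaulayLocalRing_localization_iff
    {U : X.Opens} (hU : IsAffineOpen U) (Q : Ideal Γ(X, U)) [hQ : Q.IsPrime] :
    IsCohenMacaulayLocalRing (Localization.AtPrime Q) ↔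
      IsCohenMacaulayLocalRing (X.presheaf.stalk (hU.fromSpec ⟨Q, hQ⟩)) := by
  have hmem : hU.fromSpec ⟨Q, hQ⟩ ∈ U :=
    hU.opensRange_fromSpec.le ⟨_, rfl⟩
  let _ := TopCat.Presheaf.algebra_section_stalk X.presheaf ⟨hU.fromSpec ⟨Q, hQ⟩, hmem⟩
  have hloc : IsLocalization.AtPrime (X.presheaf.stalk (hU.fromSpec ⟨Q, hQ⟩)) Q :=
    hU.isLocalization_stalk' ⟨Q, hQ⟩ hmem
  let e := (IsLocalization.algEquiv Q.primeCompl (Localization.AtPrime Q)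
    (X.presheaf.stalk (hU.fromSpec ⟨Q, hQ⟩))).toRingEquiv
  exact ⟨.of_ringEquiv e, .of_ringEquiv e.symm⟩

theorem isCohenMacaulayLocalRing_stalk (A : Type u) [CommRing A] [IsDedekindDomain A]
    (π : X ⟶ Spec (CommRingCat.of A)) [LocallyOfFiniteType π]
    (hD : IsFrobeniusSplitRelativeTo X p D)
    (hcompl : ∀ y ∈ D.compl, IsCohenMacaulayLocalRing (X.presheaf.stalk y)) (x : X) :
    IsCohenMacaulayLocalRing (X.presheaf.stalk x) := by
  obtain ⟨U, hxU, f, -, hf⟩ := D.locally_principal x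
  obtain ⟨ψ, hψ, hψf⟩ := hD.exists_apply_pow_mul hf
  obtain ⟨⟨m, hm⟩, rfl⟩ : ∃ y, U.2.fromSpec y = x :=
    ⟨U.2.primeIdealOf ⟨x, hxU⟩, U.2.fromSpec_primeIdealOf ⟨x, hxU⟩⟩
  let e := (Scheme.ΓSpecIso (CommRingCat.of A)).symm.commRingCatIsoToRingEquiv
  have hreg : IsRegularRing Γ(Spec (CommRingCat.of A), ⊤) := .of_ringEquiv (R := A) e
  let φ := π.appLE ⊤ U le_top
  let _ : Algebra Γ(Spec (CommRingCat.of A), ⊤) Γ(X, U) := φ.hom.toAlgebra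
  have hft : Algebra.FiniteType Γ(Spec (CommRingCat.of A), ⊤) Γ(X, U) :=
    π.finiteType_appLE (isAffineOpen_top _) U.2 le_top
  rw [← U.2.isCohenMacaulayLocalRing_localization_iff m]
  refine isCohenMacaulayLocalRing_localization Γ(Spec (CommRingCat.of A), ⊤)
    (IsSchemeInChar.natCast_section X p U) hψ hψf m fun Q hQ _ hfQ ↦ ?_
  rw [U.2.isCohenMacaulayLocalRing_localization_iff Q]
  refine hcompl _ ((D.mem_compl_iff hf ?_).2 ?_)
  · exact U.2.opensRange_fromSpec.le ⟨_, rfl⟩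
  · have h1 : (⟨Q, hQ⟩ : PrimeSpectrum Γ(X, U)) ∈ U.2.fromSpec ⁻¹ᵁ X.basicOpen f := by
      rw [U.2.fromSpec_preimage_basicOpen]
      exact hfQ
    exact h1

end

theorem proposition5p4 (A : Type u) [CommRing A] (hA : IsField A ∨ IsDedekindDomain A)
    (X : Scheme.{u}) (π : X ⟶ Spec (CommRingCat.of A)) [LocallyOfFiniteType π]
    (p : ℕ) [Fact p.Prime] [IsSchemeInChar X p] (hX : IsFrobeniusSplit X p)
    (D : EffectiveCartierDivisor X) (hD : IsFrobeniusSplitRelativeTo X p D)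
    (hcompl : IsCohenMacaulayScheme D.compl.toScheme) :
    IsCohenMacaulayScheme X := by
  have hA' : IsDedekindDomain A := by
    rcases hA with hA | hA
    · let _ := hA.toField
      infer_instance
    · exact hA
  refine ⟨LocallyOfFiniteType.isLocallyNoetherian π, fun x ↦
    isCohenMacaulayLocalRing_stalk A π hD (fun y hy ↦ ?_) x⟩
  let z : D.compl.toScheme := ⟨y, hy⟩
  exact .of_ringEquiv (R := D.compl.toScheme.presheaf.stalk z)
    (D.compl.stalkIso z).commRingCatIsoToRingEquiv (hcompl.stalk z)
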